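/- A finite simple graph is a \emph{splitgraph} if its vertex set can be partitioned into two (possibly empty) sets $S$ and $C$ such that $S$ is an independent set and $C$ is a clique. The \emph{categorical product} $G \times H$ of two graphs has vertex set $V(G) \times V(H)$, and $(g_1,h_1)$ and $(g_2,h_2)$ are adjacent in it if and only if $\{g_1,g_2\} \in E(G)$ and $\{h_1,h_2\} \in E(H)$. The independence number $\alpha(F)$ of a finite graph $F$ is the largest cardinality of an independent set of $F$. \textbf{Theorem.} There is a polynomial-time algorithm that, given the adjacency matrices of two splitgraphs $G$ and $H$, computes $\alpha(G \times H)$. That is, there are a single program for a random access machine (with addition, truncated subtraction, comparison with zero and indirect addressing on natural numbers, each at unit cost) and a polynomial $P$ such that, for all splitgraphs $G$ and $H$ with vertex sets $\{0,\dots,n-1\}$ and $\{0,\dots,m-1\}$, $n,m\ge 0$, the program started on the adjacency matrices of $G$ and $H$ and the numbers $n$ and $m$ halts with output $\alpha(G \times H)$ after at most $P(n+m)$ steps. -/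

import Mathlib

/-! ## Graphs -/

namespace SimpleGraph

/-- A splitgraph: the vertex set is partitioned into an independent set `S` and a clique `C`. -/
def IsSplitgraph {V : Type*} (G : SimpleGraph V) : Prop :=
  ∃ S C : Set V, Disjoint S C ∧ S ∪ C = Set.univ ∧ G.IsIndepSet S ∧ G.IsClique C

/-- The categorical product `G × H`: the pairs `(g₁, h₁)` and `(g₂, h₂)` are adjacent iff `g₁ g₂` is
an edge of `G` and `h₁ h₂` is an edge of `H`. -/
def catProd {V W : Type*} (G : SimpleGraph V) (H : SimpleGraph W) : SimpleGraph (V × W) where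
  Adj x y := G.Adj x.1 y.1 ∧ H.Adj x.2 y.2
  symm := ⟨fun _ _ h => ⟨h.1.symm, h.2.symm⟩⟩
  loopless := ⟨fun x h => G.loopless.irrefl x.1 h.1⟩

/-- The adjacency matrix of a graph on `{0, …, n - 1}`, stored row by row as a 0/1 array: the entry
for `(i, j)` is at position `n * i + j`, and the array is 0 from position `n * n` on. -/
noncomputable def adjArray {n : ℕ} (G : SimpleGraph (Fin n)) : ℕ → ℕ := by
  classical
  exact fun k => if ∃ i j : Fin n, k = n * i + j ∧ G.Adj i j then 1 else 0

end SimpleGraph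

/-! ## Random access machines with a step count

A structured program works on finitely many natural-number variables and finitely many arrays of
natural numbers, with indirect addressing. The only arithmetic is addition and truncated
subtraction (there is no multiplication), so the bit lengths of the numbers grow by at most an
additive constant in each unit of time, and polynomial time on this machine is the same as
polynomial time on a Turing machine. -/

namespace RAM

/-- Memory: variable `x` holds `var x`, and cell `i` of array `a` holds `arr a i`. -/
structure Mem where
  var : ℕ → ℕ
  arr : ℕ → ℕ → ℕ

/-- Arithmetic expressions; `get a e` reads the cell of array `a` whose index is the value of
`e`. -/
inductive Expr where
  | lit (k : ℕ)
  | var (x : ℕ)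
  | get (a : ℕ) (e : Expr)
  | add (e₁ e₂ : Expr)
  | sub (e₁ e₂ : Expr)

/-- The value of an expression. -/
def Expr.eval (s : Mem) : Expr → ℕ
  | lit k => k
  | var x => s.var x
  | get a e => s.arr a (e.eval s)
  | add e₁ e₂ => e₁.eval s + e₂.eval s
  | sub e₁ e₂ => e₁.eval s - e₂.eval s

/-- The time to evaluate an expression: one unit for each constant, variable access, array access
and arithmetic operation. -/
def Expr.cost : Expr → ℕ
  | lit _ => 1
  | var _ => 1
  | get _ e => e.cost + 1
  | add e₁ e₂ => e₁.cost + e₂.cost + 1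
  | sub e₁ e₂ => e₁.cost + e₂.cost + 1

/-- Programs. A test `e` succeeds iff the value of `e` is not 0. -/
inductive Prog where
  | skip
  /-- `x := e` -/
  | assign (x : ℕ) (e : Expr)
  /-- `a[e₁] := e₂` -/
  | put (a : ℕ) (e₁ e₂ : Expr)
  /-- `p; q` -/
  | seq (p q : Prog)
  /-- if `e` succeeds then `p` else `q` -/
  | ite (e : Expr) (p q : Prog)
  /-- while `e` succeeds do `p` -/
  | loop (e : Expr) (p : Prog)

/-- Set variable `x` to `v`. -/
def Mem.setVar (s : Mem) (x v : ℕ) : Mem where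
  var := Function.update s.var x v
  arr := s.arr

/-- Set cell `i` of array `a` to `v`. -/
def Mem.setArr (s : Mem) (a i v : ℕ) : Mem where
  var := s.var
  arr := Function.update s.arr a (Function.update (s.arr a) i v)

/-- `Runs p s t s'`: the program `p`, started in memory `s`, halts after time exactly `t` in
memory `s'`. -/
inductive Runs : Prog → Mem → ℕ → Mem → Prop where
  | skip (s : Mem) : Runs .skip s 1 s
  | assign (x : ℕ) (e : Expr) (s : Mem) :
      Runs (.assign x e) s (e.cost + 1) (s.setVar x (e.eval s))
  | put (a : ℕ) (e₁ e₂ : Expr) (s : Mem) :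
      Runs (.put a e₁ e₂) s (e₁.cost + e₂.cost + 1) (s.setArr a (e₁.eval s) (e₂.eval s))
  | seq {p q : Prog} {s s' s'' : Mem} {t t' : ℕ} :
      Runs p s t s' → Runs q s' t' s'' → Runs (.seq p q) s (t + t') s''
  | ite_true {e : Expr} {p q : Prog} {s s' : Mem} {t : ℕ} :
      e.eval s ≠ 0 → Runs p s t s' → Runs (.ite e p q) s (e.cost + 1 + t) s'
  | ite_false {e : Expr} {p q : Prog} {s s' : Mem} {t : ℕ} :
      e.eval s = 0 → Runs q s t s' → Runs (.ite e p q) s (e.cost + 1 + t) s'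
  | loop_true {e : Expr} {p : Prog} {s s' s'' : Mem} {t t' : ℕ} :
      e.eval s ≠ 0 → Runs p s t s' → Runs (.loop e p) s' t' s'' →
      Runs (.loop e p) s (e.cost + 1 + t + t') s''
  | loop_false {e : Expr} {p : Prog} {s : Mem} :
      e.eval s = 0 → Runs (.loop e p) s (e.cost + 1) s

/-- Programs are deterministic: the running time and the final memory are unique. -/
theorem Runs.unique {p : Prog} {s s₁ s₂ : Mem} {t₁ t₂ : ℕ} (h₁ : Runs p s t₁ s₁)
    (h₂ : Runs p s t₂ s₂) : t₁ = t₂ ∧ s₁ = s₂ := by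
  induction h₁ generalizing t₂ s₂ with
  | skip | assign | put => cases h₂; exact ⟨rfl, rfl⟩
  | seq _ _ ih ih' =>
    cases h₂ with
    | seq a b =>
      obtain ⟨rfl, rfl⟩ := ih a
      obtain ⟨rfl, rfl⟩ := ih' b
      exact ⟨rfl, rfl⟩
  | ite_true hc _ ih =>
    cases h₂ with
    | ite_true _ a => obtain ⟨rfl, rfl⟩ := ih a; exact ⟨rfl, rfl⟩
    | ite_false h _ => exact absurd h hc
  | ite_false hc _ ih =>
    cases h₂ with
    | ite_true h _ => exact absurd hc h
    | ite_false _ a => obtain ⟨rfl, rfl⟩ := ih a; exact ⟨rfl, rfl⟩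
  | loop_true hc _ _ ih ih' =>
    cases h₂ with
    | loop_true _ a b =>
      obtain ⟨rfl, rfl⟩ := ih a
      obtain ⟨rfl, rfl⟩ := ih' b
      exact ⟨rfl, rfl⟩
    | loop_false h => exact absurd h hc
  | loop_false hc =>
    cases h₂ with
    | loop_true h _ _ => exact absurd hc h
    | loop_false _ => exact ⟨rfl, rfl⟩

/-- The initial memory for a pair of input graphs: variables 0 and 1 hold the numbers of vertices,
arrays 0 and 1 hold the adjacency matrices, and everything else is 0. -/
noncomputable def inputMem {n m : ℕ} (G : SimpleGraph (Fin n)) (H : SimpleGraph (Fin m)) : Mem where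
  var x := if x = 0 then n else if x = 1 then m else 0
  arr a := if a = 0 then G.adjArray else if a = 1 then H.adjArray else fun _ => 0

end RAM

/-! The algorithm reduces the problem to polynomially many bipartite independent set problems. A
splitgraph has a split into clique and independent set given by a degree threshold
(`IsSplitgraph.exists_threshold`), so only `n + 1` and `m + 1` candidates have to be tried for the
cliques `C` of `G` and `D` of `H`. Given these, let `I` be a largest independent set of the product.
Distinct vertices of `I` in `C × D` must share a coordinate. Either `I` has two vertices `a ≠ b`
there, or at most one. In both cases a pair `a, b` (with `a = b` in the second case) determines a
region that contains `I` and induces a bipartite graph with explicit sides (`exists_prodRegion`).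

The independence number of a bipartite graph is the number of vertices minus the size of a maximum
matching. An auction finds such a matching: an unmatched left vertex takes its cheapest neighbour,
possibly evicting the current mate, and raises the price by one. A gap in the final prices yields an
independent set that certifies optimality (`Auction.Inv.card_le`, `Auction.Inv.exists_card`). The
total price is bounded and grows in every sweep that does anything, so polynomially many sweeps
suffice (`Auction.not_guard_run`).

The program tries all thresholds and pairs, and skips a choice whose two sides are not independent.
Every remaining choice gives the size of a genuine independent set, even with wrong thresholds, and
some choice gives `α` (`Chosen.body`, `Loaded.search`).

For the running time, the program is written with sums and loops whose common bound is the value of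
variable 2. Compilation to the machine comes with a time bound polynomial in that value
(`RExpr.runsIn_compile`, `Stmt.runsIn_compile`). The bound used is `(n + m + 2) ^ 4`. -/

/-! ## A language with bounded sums and bounded loops, compiled to the machine -/

namespace RAM

/-- Expressions with case distinction and sums over all `k` below the value of variable 2. -/
inductive RExpr where
  | lit (k : ℕ)
  | var (x : ℕ)
  | get (a : ℕ) (e : RExpr)
  | add (e₁ e₂ : RExpr)
  | sub (e₁ e₂ : RExpr)
  | ite (c e₁ e₂ : RExpr)
  | sum (x : ℕ) (e : RExpr)

namespace RExpr

/-- The value of an expression. -/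
def eval : RExpr → Mem → ℕ
  | lit k, _ => k
  | var x, s => s.var x
  | get a e, s => s.arr a (e.eval s)
  | add e₁ e₂, s => e₁.eval s + e₂.eval s
  | sub e₁ e₂, s => e₁.eval s - e₂.eval s
  | ite c e₁ e₂, s => if c.eval s = 0 then e₂.eval s else e₁.eval s
  | sum x e, s => ∑ k ∈ Finset.range (s.var 2), e.eval (s.setVar x k)

/-- All variables are below `r`, and variable 2 is not bound. -/
def varsBelow (r : ℕ) : RExpr → Bool
  | lit _ => true
  | var x => decide (x < r)
  | get _ e => e.varsBelow r
  | add e₁ e₂ => e₁.varsBelow r && e₂.varsBelow r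
  | sub e₁ e₂ => e₁.varsBelow r && e₂.varsBelow r
  | ite c e₁ e₂ => c.varsBelow r && (e₁.varsBelow r && e₂.varsBelow r)
  | sum x e => decide (x < r) && (decide (x ≠ 2) && e.varsBelow r)

/-- A program that stores the value of the expression in variable `r` and does not change the
variables below `r`. -/
def compile : RExpr → ℕ → Prog
  | lit k, r => .assign r (.lit k)
  | var x, r => .assign r (.var x)
  | get a e, r => .seq (e.compile r) (.assign r (.get a (.var r)))
  | add e₁ e₂, r => .seq (e₁.compile r) (.seq (e₂.compile (r + 1))
      (.assign r (.add (.var r) (.var (r + 1)))))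
  | sub e₁ e₂, r => .seq (e₁.compile r) (.seq (e₂.compile (r + 1))
      (.assign r (.sub (.var r) (.var (r + 1)))))
  | ite c e₁ e₂, r => .seq (c.compile r) (.ite (.var r) (e₁.compile r) (e₂.compile r))
  | sum x e, r => .seq (.assign r (.lit 0)) (.seq (.assign (r + 1) (.lit 0))
      (.seq (.assign (r + 2) (.var x))
      (.seq (.loop (.sub (.var 2) (.var (r + 1)))
        (.seq (.assign x (.var (r + 1))) (.seq (e.compile (r + 3))
          (.seq (.assign r (.add (.var r) (.var (r + 3))))
            (.assign (r + 1) (.add (.var (r + 1)) (.lit 1)))))))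
      (.assign x (.var (r + 2))))))

/-- A bound for the running time of the compiled expression, in terms of the value of
variable 2. -/
noncomputable def time : RExpr → Polynomial ℕ
  | lit _ => 2
  | var _ => 2
  | get _ e => e.time + 3
  | add e₁ e₂ => e₁.time + (e₂.time + 4)
  | sub e₁ e₂ => e₁.time + (e₂.time + 4)
  | ite c e₁ e₂ => c.time + (2 + (e₁.time + e₂.time))
  | sum _ e => 2 + (2 + (2 + ((Polynomial.X * (4 + (2 + (e.time + (4 + 4)))) + 4) + 2)))

end RExpr

/-! ### Correctness and running time of compiled expressions -/

/-- Two memories have the same arrays and the same variables below `r`. -/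
def Mem.Agree (r : ℕ) (s s' : Mem) : Prop :=
  (∀ x < r, s'.var x = s.var x) ∧ s'.arr = s.arr

theorem Mem.Agree.refl (r : ℕ) (s : Mem) : s.Agree r s := ⟨fun _ _ => rfl, rfl⟩

theorem Mem.Agree.trans {r : ℕ} {s s' s'' : Mem} (h : s.Agree r s') (h' : s'.Agree r s'') :
    s.Agree r s'' :=
  ⟨fun x hx => (h'.1 x hx).trans (h.1 x hx), h'.2.trans h.2⟩

theorem Mem.Agree.mono {r r' : ℕ} {s s' : Mem} (h : s.Agree r s') (hr : r' ≤ r) :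
    s.Agree r' s' :=
  ⟨fun x hx => h.1 x (hx.trans_le hr), h.2⟩

theorem Mem.Agree.setVar {r : ℕ} {s s' : Mem} (h : s.Agree r s') (x v : ℕ) :
    (s.setVar x v).Agree r (s'.setVar x v) := by
  refine ⟨fun y hy => ?_, h.2⟩
  by_cases hxy : y = x
  · subst hxy; simp [Mem.setVar]
  · simp [Mem.setVar, hxy, h.1 y hy]

theorem Mem.agree_setVar {r x : ℕ} (s : Mem) (v : ℕ) (hx : r ≤ x) : s.Agree r (s.setVar x v) :=
  ⟨fun y hy => by simp [Mem.setVar, (hy.trans_le hx).ne], rfl⟩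

@[simp] theorem Mem.setVar_var_self (s : Mem) (x v : ℕ) : (s.setVar x v).var x = v := by
  simp [Mem.setVar]

theorem Mem.setVar_var_of_ne (s : Mem) {x y : ℕ} (v : ℕ) (h : y ≠ x) :
    (s.setVar x v).var y = s.var y := by
  simp [Mem.setVar, h]

@[simp] theorem Mem.setVar_arr (s : Mem) (x v : ℕ) : (s.setVar x v).arr = s.arr := rfl

@[simp] theorem Mem.setArr_var (s : Mem) (a i v : ℕ) : (s.setArr a i v).var = s.var := rfl

theorem RExpr.eval_congr {r : ℕ} (e : RExpr) (he : e.varsBelow r = true) (hr : 2 < r) {s s' : Mem}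
    (h : s.Agree r s') : e.eval s' = e.eval s := by
  induction e generalizing s s' with
  | lit k => rfl
  | var x => exact h.1 x (by simpa [varsBelow] using he)
  | get a e ih => simp only [eval, ih he h, h.2]
  | add e₁ e₂ ih₁ ih₂ | sub e₁ e₂ ih₁ ih₂ =>
    simp only [varsBelow, Bool.and_eq_true] at he
    simp only [eval, ih₁ he.1 h, ih₂ he.2 h]
  | ite c e₁ e₂ ih ih₁ ih₂ =>
    simp only [varsBelow, Bool.and_eq_true] at he
    simp only [eval, ih he.1 h, ih₁ he.2.1 h, ih₂ he.2.2 h]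
  | sum x e ih =>
    simp only [varsBelow, Bool.and_eq_true] at he
    simp only [eval, h.1 2 hr]
    exact Finset.sum_congr rfl fun k _ => ih he.2.2 (h.setVar x k)

/-- The program halts in memory `s'` after at most `T` steps. -/
def RunsIn (p : Prog) (s : Mem) (T : ℕ) (s' : Mem) : Prop := ∃ t ≤ T, Runs p s t s'

theorem RunsIn.mono {p : Prog} {s s' : Mem} {T T' : ℕ} (h : RunsIn p s T s') (hT : T ≤ T') :
    RunsIn p s T' s' :=
  let ⟨t, ht, h⟩ := h
  ⟨t, ht.trans hT, h⟩

theorem RunsIn.assign (x : ℕ) (e : Expr) (s : Mem) :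
    RunsIn (.assign x e) s (e.cost + 1) (s.setVar x (e.eval s)) :=
  ⟨_, le_rfl, .assign x e s⟩

theorem RunsIn.put (a : ℕ) (e₁ e₂ : Expr) (s : Mem) :
    RunsIn (.put a e₁ e₂) s (e₁.cost + e₂.cost + 1) (s.setArr a (e₁.eval s) (e₂.eval s)) :=
  ⟨_, le_rfl, .put a e₁ e₂ s⟩

theorem RunsIn.seq {p q : Prog} {s s' s'' : Mem} {T T' : ℕ} (h : RunsIn p s T s')
    (h' : RunsIn q s' T' s'') : RunsIn (.seq p q) s (T + T') s'' :=
  let ⟨_, ht, h⟩ := h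
  let ⟨_, ht', h'⟩ := h'
  ⟨_, Nat.add_le_add ht ht', .seq h h'⟩

theorem RunsIn.ite_true {e : Expr} {p q : Prog} {s s' : Mem} {T : ℕ} (he : e.eval s ≠ 0)
    (h : RunsIn p s T s') : RunsIn (.ite e p q) s (e.cost + 1 + T) s' :=
  let ⟨_, ht, h⟩ := h
  ⟨_, Nat.add_le_add_left ht _, .ite_true he h⟩

theorem RunsIn.ite_false {e : Expr} {p q : Prog} {s s' : Mem} {T : ℕ} (he : e.eval s = 0)
    (h : RunsIn q s T s') : RunsIn (.ite e p q) s (e.cost + 1 + T) s' :=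
  let ⟨_, ht, h⟩ := h
  ⟨_, Nat.add_le_add_left ht _, .ite_false he h⟩

/-- A loop whose test counts down from `N` and whose body advances the invariant `I`. -/
theorem RunsIn.loop {e : Expr} {p : Prog} {N T : ℕ} (I : ℕ → Mem → Prop)
    (he : ∀ k s, I k s → e.eval s = N - k)
    (hp : ∀ k < N, ∀ s, I k s → ∃ s', RunsIn p s T s' ∧ I (k + 1) s') {s : Mem} (hs : I 0 s) :
    ∃ s', RunsIn (.loop e p) s (N * (e.cost + 1 + T) + (e.cost + 1)) s' ∧ I N s' := by
  -- The induction is on the number `j` of rounds still to come, since a run of the loop unfolds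
  -- from its first round.
  suffices H : ∀ j k s, k + j = N → I k s →
      ∃ s', RunsIn (.loop e p) s (j * (e.cost + 1 + T) + (e.cost + 1)) s' ∧ I N s' from
    H N 0 s (by simp) hs
  intro j
  induction j with
  | zero =>
    intro k s hk hI
    obtain rfl : k = N := by simpa using hk
    exact ⟨s, ⟨_, by simp, .loop_false (by simp [he _ _ hI])⟩, hI⟩
  | succ j ih =>
    intro k s hk hI
    obtain ⟨s', ⟨t, ht, h⟩, hI'⟩ := hp k (by omega) s hI
    obtain ⟨s'', ⟨t', ht', h'⟩, hI''⟩ := ih (k + 1) s' (by omega) hI'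
    refine ⟨s'', ⟨_, ?_, .loop_true (by rw [he _ _ hI]; omega) h h'⟩, hI''⟩
    rw [Nat.succ_mul]
    omega

/-- Registers from `r` on are scratch space, and the source variables lie below `r₀ ≤ r`. A first
operand in `r` survives because the second one is compiled at `r + 1`. The bound variable of a sum
is overwritten but restored at the end, which is why agreement can be claimed for all variables
below `r`. -/
theorem RExpr.runsIn_compile {r₀ : ℕ} (h2 : 2 < r₀) (e : RExpr) (he : e.varsBelow r₀ = true) {r : ℕ}
    (hr : r₀ ≤ r) (s : Mem) :
    ∃ s', RunsIn (e.compile r) s (e.time.eval (s.var 2)) s' ∧ s'.var r = e.eval s ∧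
      s.Agree r s' := by
  induction e generalizing s r with
  | lit k =>
    exact ⟨_, (RunsIn.assign _ _ _).mono (by simp [time, Expr.cost]),
      by simp [Expr.eval, eval], s.agree_setVar _ le_rfl⟩
  | var x =>
    exact ⟨_, (RunsIn.assign _ _ _).mono (by simp [time, Expr.cost]),
      by simp [Expr.eval, eval], s.agree_setVar _ le_rfl⟩
  | get a e ih =>
    obtain ⟨s₁, h₁, v₁, a₁⟩ := ih he hr s
    refine ⟨_, (h₁.seq (RunsIn.assign _ _ _)).mono (by simp [time, Expr.cost]), ?_,
      a₁.trans (s₁.agree_setVar _ le_rfl)⟩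
    simp [Expr.eval, eval, v₁, a₁.2]
  | add e₁ e₂ ih₁ ih₂ | sub e₁ e₂ ih₁ ih₂ =>
    simp only [varsBelow, Bool.and_eq_true] at he
    obtain ⟨s₁, h₁, v₁, a₁⟩ := ih₁ he.1 hr s
    obtain ⟨s₂, h₂, v₂, a₂⟩ := ih₂ he.2 (r := r + 1) (by omega) s₁
    refine ⟨_, (h₁.seq (h₂.seq (RunsIn.assign _ _ _))).mono ?_, ?_,
      (a₁.trans (a₂.mono (by omega))).trans (s₂.agree_setVar _ le_rfl)⟩
    · simp [time, Expr.cost, a₁.1 2 (by omega)]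
    · simp [Expr.eval, eval, v₂, a₂.1 r (by omega), v₁,
        e₂.eval_congr he.2 h2 (a₁.mono hr)]
  | ite c e₁ e₂ ih ih₁ ih₂ =>
    simp only [varsBelow, Bool.and_eq_true] at he
    obtain ⟨s₁, h₁, v₁, a₁⟩ := ih he.1 hr s
    by_cases hc : c.eval s = 0
    · obtain ⟨s₂, h₂, v₂, a₂⟩ := ih₂ he.2.2 hr s₁
      refine ⟨s₂, (h₁.seq (RunsIn.ite_false (by simp [Expr.eval, v₁, hc]) h₂)).mono ?_, ?_,
        a₁.trans a₂⟩
      · simp [time, Expr.cost, a₁.1 2 (by omega)]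
      · simp [v₂, eval, hc, e₂.eval_congr he.2.2 h2 (a₁.mono hr)]
    · obtain ⟨s₂, h₂, v₂, a₂⟩ := ih₁ he.2.1 hr s₁
      refine ⟨s₂, (h₁.seq (RunsIn.ite_true (by simp [Expr.eval, v₁, hc]) h₂)).mono ?_, ?_,
        a₁.trans a₂⟩
      · simp [time, Expr.cost, a₁.1 2 (by omega)]
      · simp [v₂, eval, hc, e₁.eval_congr he.2.1 h2 (a₁.mono hr)]
  | sum x e ih =>
    simp only [varsBelow, Bool.and_eq_true, decide_eq_true_eq] at he
    obtain ⟨hx, hx2, he⟩ := he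
    -- Register `r` accumulates, `r + 1` counts and `r + 2` keeps the old value of `x`. During the
    -- loop `x` itself is exempt from agreement.
    let I : ℕ → Mem → Prop := fun k s' =>
      s'.var r = ∑ i ∈ Finset.range k, e.eval (s.setVar x i) ∧ s'.var (r + 1) = k ∧
        s'.var (r + 2) = s.var x ∧ (∀ y < r, y ≠ x → s'.var y = s.var y) ∧ s'.arr = s.arr
    have hI₀ : I 0 (((s.setVar r 0).setVar (r + 1) 0).setVar (r + 2) (s.var x)) := by
      refine ⟨?_, ?_, ?_, ?_, rfl⟩
      · simp [Mem.setVar]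
      · simp [Mem.setVar]
      · simp [Mem.setVar]
      · intro y hy hyx
        simp [Mem.setVar, hy.ne, show y ≠ r + 1 by omega, show y ≠ r + 2 by omega]
    obtain ⟨s₁, h₁, hI⟩ := RunsIn.loop (e := .sub (.var 2) (.var (r + 1)))
      (p := .seq (.assign x (.var (r + 1))) (.seq (e.compile (r + 3))
          (.seq (.assign r (.add (.var r) (.var (r + 3))))
            (.assign (r + 1) (.add (.var (r + 1)) (.lit 1))))))
      (N := s.var 2) (T := 2 + (e.time.eval (s.var 2) + (4 + 4))) I
      (fun k s' hI => by simp [Expr.eval, hI.2.1, hI.2.2.2.1 2 (by omega) (Ne.symm hx2)])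
      (by
        rintro k - s' ⟨v₁, v₂, v₃, v₄, v₅⟩
        obtain ⟨s₁, h₁, w₁, a₁⟩ := ih he (r := r + 3) (by omega) (s'.setVar x k)
        have hk : Expr.eval s' (.var (r + 1)) = k := v₂
        have hA := RunsIn.assign x (.var (r + 1)) s'
        rw [hk] at hA
        have hr1 : r ≠ x := by omega
        have hr2 : r + 1 ≠ x := by omega
        have hr3 : r + 2 ≠ x := by omega
        have hag : (s.setVar x k).Agree r₀ (s'.setVar x k) := by
          refine ⟨fun y hy => ?_, v₅⟩
          by_cases hyx : y = x
          · simp [hyx]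
          · rw [Mem.setVar_var_of_ne _ _ hyx, Mem.setVar_var_of_ne _ _ hyx]
            exact v₄ y (by omega) hyx
        rw [Mem.setVar_var_of_ne _ _ (Ne.symm hx2), v₄ 2 (by omega) (Ne.symm hx2)] at h₁
        refine ⟨_, (hA.seq (h₁.seq
          ((RunsIn.assign _ _ _).seq (RunsIn.assign _ _ _)))).mono ?_, ?_, ?_, ?_, ?_, ?_⟩
        · simp [Expr.cost]
        · rw [Finset.sum_range_succ, ← v₁, ← e.eval_congr he h2 hag]
          simp [Mem.setVar, Expr.eval, w₁, a₁.1 r (by omega), hr1]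
        · simp [Mem.setVar, Expr.eval, a₁.1 (r + 1) (by omega), hr2, v₂]
        · simp [Mem.setVar, a₁.1 (r + 2) (by omega), hr3, v₃]
        · intro y hy hyx
          simp [Mem.setVar, hy.ne, show y ≠ r + 1 by omega, a₁.1 y (by omega), hyx, v₄ y hy hyx]
        · simp [a₁.2, v₅])
      hI₀
    obtain ⟨v₁, v₂, v₃, v₄, v₅⟩ := hI
    have hv : Expr.eval ((s.setVar r 0).setVar (r + 1) 0) (.var x) = s.var x := by
      simp [Expr.eval, Mem.setVar, show x ≠ r by omega, show x ≠ r + 1 by omega]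
    have hA := RunsIn.assign (r + 2) (.var x) ((s.setVar r 0).setVar (r + 1) 0)
    rw [hv] at hA
    refine ⟨_, ((RunsIn.assign r (.lit 0) s).seq ((RunsIn.assign (r + 1) (.lit 0) _).seq
      (hA.seq
        (h₁.seq (RunsIn.assign x (.var (r + 2)) _))))).mono ?_, ?_, ?_, ?_⟩
    · simp [time, Expr.cost]
    · simp [Mem.setVar, show r ≠ x by omega, v₁, eval]
    · intro y hy
      by_cases hyx : y = x
      · simp [Expr.eval, hyx, v₃]
      · simp [Mem.setVar, hyx, v₄ y hy hyx]
    · simp [v₅]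

/-! ### Statements and their compilation -/

/-- `f 0`, `f 1`, …, `f (N - 1)` applied in this order. -/
def iterate {σ : Type*} (f : ℕ → σ → σ) : ℕ → σ → σ
  | 0, s => s
  | N + 1, s => f N (iterate f N s)

/-- Statements; `iter x p` runs `p` with `x = 0, 1, …` for all values below that of variable 2. -/
inductive Stmt where
  | assign (x : ℕ) (e : RExpr)
  | put (a : ℕ) (e₁ e₂ : RExpr)
  | seq (p q : Stmt)
  | cond (e : RExpr) (p : Stmt)
  | iter (x : ℕ) (p : Stmt)

namespace Stmt

/-- The effect of a statement on the memory. -/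
def exec : Stmt → Mem → Mem
  | assign x e, s => s.setVar x (e.eval s)
  | put a e₁ e₂, s => s.setArr a (e₁.eval s) (e₂.eval s)
  | seq p q, s => q.exec (p.exec s)
  | cond e p, s => if e.eval s = 0 then s else p.exec s
  | iter x p, s => iterate (fun k s' => p.exec (s'.setVar x k)) (s.var 2) s

/-- All variables are below `r`, and variable 2 is not changed. -/
def varsBelow (r : ℕ) : Stmt → Bool
  | assign x e => decide (x < r) && (decide (x ≠ 2) && e.varsBelow r)
  | put _ e₁ e₂ => e₁.varsBelow r && e₂.varsBelow r
  | seq p q => p.varsBelow r && q.varsBelow r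
  | cond e p => e.varsBelow r && p.varsBelow r
  | iter x p => decide (x < r) && (decide (x ≠ 2) && p.varsBelow r)

/-- A program with the effect of the statement on the arrays and the variables below `r`. -/
def compile : Stmt → ℕ → Prog
  | assign x e, r => .seq (e.compile r) (.assign x (.var r))
  | put a e₁ e₂, r => .seq (e₁.compile r) (.seq (e₂.compile (r + 1))
      (.put a (.var r) (.var (r + 1))))
  | seq p q, r => .seq (p.compile r) (q.compile r)
  | cond e p, r => .seq (e.compile r) (.ite (.var r) (p.compile r) .skip)
  | iter x p, r => .seq (.assign r (.lit 0)) (.loop (.sub (.var 2) (.var r))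
      (.seq (.assign x (.var r)) (.seq (p.compile (r + 1))
        (.assign r (.add (.var r) (.lit 1))))))

/-- A bound for the running time of the compiled statement, in terms of the value of
variable 2. -/
noncomputable def time : Stmt → Polynomial ℕ
  | assign _ e => e.time + 2
  | put _ e₁ e₂ => e₁.time + (e₂.time + 3)
  | seq p q => p.time + q.time
  | cond e p => e.time + (2 + (p.time + 1))
  | iter _ p => 2 + (Polynomial.X * (4 + (2 + (p.time + 4))) + 4)

theorem exec_var_two {r : ℕ} (p : Stmt) (hp : p.varsBelow r = true) (s : Mem) :
    (p.exec s).var 2 = s.var 2 := by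
  induction p generalizing s with
  | assign x e =>
    simp only [varsBelow, Bool.and_eq_true, decide_eq_true_eq] at hp
    exact Mem.setVar_var_of_ne _ _ (Ne.symm hp.2.1)
  | put a e₁ e₂ => rfl
  | seq p q ih₁ ih₂ =>
    simp only [varsBelow, Bool.and_eq_true] at hp
    simp only [exec, ih₁ hp.1, ih₂ hp.2]
  | cond e p ih =>
    simp only [varsBelow, Bool.and_eq_true] at hp
    simp only [exec]
    split_ifs
    · rfl
    · exact ih hp.2 s
  | iter x p ih =>
    simp only [varsBelow, Bool.and_eq_true, decide_eq_true_eq] at hp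
    simp only [exec]
    suffices H : ∀ N, (iterate (fun k s' => p.exec (s'.setVar x k)) N s).var 2 = s.var 2 from
      H _
    intro N
    induction N with
    | zero => rfl
    | succ k ihk => rw [iterate, ih hp.2.2, Mem.setVar_var_of_ne _ _ (Ne.symm hp.2.1), ihk]

/-- This is a simulation: the machine memory `s` follows the abstract memory `s₀` only below `r₀`,
as scratch registers have no abstract counterpart. The last conclusion protects the counter of an
enclosing loop, kept in a register between `r₀` and `r`. Variable 2 never changes, so one time bound
serves all rounds. -/
theorem runsIn_compile {r₀ : ℕ} (h2 : 2 < r₀) (p : Stmt) (hp : p.varsBelow r₀ = true) {r : ℕ}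
    (hr : r₀ ≤ r) {s₀ s : Mem} (hs : s₀.Agree r₀ s) :
    ∃ s', RunsIn (p.compile r) s (p.time.eval (s.var 2)) s' ∧ (p.exec s₀).Agree r₀ s' ∧
      ∀ y, r₀ ≤ y → y < r → s'.var y = s.var y := by
  induction p generalizing s₀ s r with
  | assign x e =>
    simp only [varsBelow, Bool.and_eq_true, decide_eq_true_eq] at hp
    obtain ⟨s₁, h₁, v₁, a₁⟩ := e.runsIn_compile h2 hp.2.2 hr s
    refine ⟨_, (h₁.seq (RunsIn.assign _ _ _)).mono (by simp [time, Expr.cost]), ?_, ?_⟩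
    · rw [Expr.eval, v₁, e.eval_congr hp.2.2 h2 hs]
      exact (hs.trans (a₁.mono hr)).setVar _ _
    · intro y hy hyr
      rw [Mem.setVar_var_of_ne _ _ (by omega), a₁.1 y hyr]
  | put a e₁ e₂ =>
    simp only [varsBelow, Bool.and_eq_true] at hp
    obtain ⟨s₁, h₁, v₁, a₁⟩ := e₁.runsIn_compile h2 hp.1 hr s
    obtain ⟨s₂, h₂, v₂, a₂⟩ := e₂.runsIn_compile h2 hp.2 (r := r + 1) (by omega) s₁
    have hag := hs.trans ((a₁.mono hr).trans (a₂.mono (by omega)))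
    refine ⟨_, (h₁.seq (h₂.seq (RunsIn.put _ _ _ _))).mono ?_, ?_, ?_⟩
    · simp [time, Expr.cost, a₁.1 2 (by omega)]
    · rw [Expr.eval, Expr.eval, v₂, a₂.1 r (by omega), v₁, e₁.eval_congr hp.1 h2 hs,
        e₂.eval_congr hp.2 h2 (hs.trans (a₁.mono hr))]
      exact ⟨hag.1, by simp [exec, Mem.setArr, hag.2]⟩
    · intro y hy hyr
      rw [Mem.setArr_var, a₂.1 y (by omega), a₁.1 y hyr]
  | seq p q ih₁ ih₂ =>
    simp only [varsBelow, Bool.and_eq_true] at hp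
    obtain ⟨s₁, h₁, a₁, v₁⟩ := ih₁ hp.1 hr hs
    obtain ⟨s₂, h₂, a₂, v₂⟩ := ih₂ hp.2 hr a₁
    refine ⟨s₂, (h₁.seq h₂).mono ?_, a₂, fun y hy hyr => (v₂ y hy hyr).trans (v₁ y hy hyr)⟩
    rw [a₁.1 2 h2, p.exec_var_two hp.1, ← hs.1 2 h2]
    simp [time]
  | cond e p ih =>
    simp only [varsBelow, Bool.and_eq_true] at hp
    obtain ⟨s₁, h₁, v₁, a₁⟩ := e.runsIn_compile h2 hp.1 hr s
    rw [e.eval_congr hp.1 h2 hs] at v₁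
    by_cases hc : e.eval s₀ = 0
    · refine ⟨s₁, (h₁.seq (RunsIn.ite_false (by simp [Expr.eval, v₁, hc])
        ⟨1, le_rfl, .skip s₁⟩)).mono ?_, ?_, fun y _ hyr => a₁.1 y hyr⟩
      · simp [time, Expr.cost]
        omega
      · simp only [exec, hc, if_true]
        exact hs.trans (a₁.mono hr)
    · obtain ⟨s₂, h₂, a₂, v₂⟩ := ih hp.2 hr (hs.trans (a₁.mono hr))
      refine ⟨s₂, (h₁.seq (RunsIn.ite_true (by simp [Expr.eval, v₁, hc]) h₂)).mono ?_, ?_,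
        fun y hy hyr => (v₂ y hy hyr).trans (a₁.1 y hyr)⟩
      · simp [time, Expr.cost, a₁.1 2 (by omega)]
      · simpa only [exec, hc, if_false] using a₂
  | iter x p ih =>
    simp only [varsBelow, Bool.and_eq_true, decide_eq_true_eq] at hp
    obtain ⟨hx, hx2, hp⟩ := hp
    let F : ℕ → Mem := fun k => iterate (fun k s' => p.exec (s'.setVar x k)) k s₀
    have hF : ∀ k, (F k).var 2 = s.var 2 := by
      intro k
      induction k with
      | zero => exact (hs.1 2 h2).symm
      | succ k ihk =>
        rw [← ihk, ← Mem.setVar_var_of_ne (F k) k (Ne.symm hx2)]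
        exact p.exec_var_two hp _
    obtain ⟨s₁, h₁, hI⟩ := RunsIn.loop (e := .sub (.var 2) (.var r))
      (p := .seq (.assign x (.var r)) (.seq (p.compile (r + 1))
        (.assign r (.add (.var r) (.lit 1)))))
      (N := s.var 2) (T := 2 + (p.time.eval (s.var 2) + 4))
      (fun k s' => s'.var r = k ∧ (F k).Agree r₀ s' ∧ ∀ y, r₀ ≤ y → y < r → s'.var y = s.var y)
      (fun k s' hI => by simp [Expr.eval, hI.1, hI.2.1.1 2 h2, hF])
      (by
        rintro k - s' ⟨v₁, v₂, v₃⟩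
        obtain ⟨s₁, h₁, a₁, w₁⟩ := ih hp (r := r + 1) (by omega) (v₂.setVar x k)
        rw [Mem.setVar_var_of_ne _ _ (Ne.symm hx2), v₂.1 2 h2, hF] at h₁
        have hA := RunsIn.assign x (.var r) s'
        rw [show Expr.eval s' (.var r) = k from v₁] at hA
        refine ⟨_, (hA.seq (h₁.seq (RunsIn.assign _ _ _))).mono ?_, ?_, ?_, ?_⟩
        · simp [Expr.cost]
        · simp [Expr.eval, w₁ r hr (by omega), Mem.setVar, show r ≠ x by omega, v₁]
        · exact a₁.trans (s₁.agree_setVar _ hr)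
        · intro y hy hyr
          rw [Mem.setVar_var_of_ne _ _ (by omega), w₁ y hy (by omega),
            Mem.setVar_var_of_ne _ _ (by omega), v₃ y hy hyr])
      (s := s.setVar r 0)
      ⟨by simp, hs.trans (s.agree_setVar _ hr),
        fun y _ hyr => Mem.setVar_var_of_ne _ _ (by omega)⟩
    refine ⟨s₁, ((RunsIn.assign r (.lit 0) s).seq h₁).mono ?_, ?_, hI.2.2⟩
    · simp [time, Expr.cost]
    · have := hI.2.1
      simp only [exec, ← hs.1 2 h2]
      exact this

end Stmt

end RAM

/-! ## Splitgraphs and independent sets of their products -/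

namespace SimpleGraph

open scoped Classical in
/-- Every splitgraph is split by a threshold on the degrees. -/
theorem IsSplitgraph.exists_threshold {V : Type*} [Fintype V] {G : SimpleGraph V}
    (hG : G.IsSplitgraph) :
    ∃ k ≤ Fintype.card V, G.IsClique {v | k ≤ (Finset.univ.filter (G.Adj v)).card} ∧
      G.IsIndepSet {v | (Finset.univ.filter (G.Adj v)).card < k} := by
  let Good : Finset V → Prop := fun C => G.IsClique (C : Set V) ∧ G.IsIndepSet (C : Set V)ᶜ
  have hne : ∃ C, Good C := by
    obtain ⟨S, C, hd, hu, hS, hC⟩ := hG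
    refine ⟨C.toFinset, by simpa using hC, ?_⟩
    have : (↑C.toFinset : Set V)ᶜ = S := by
      rw [Set.coe_toFinset]
      exact (IsCompl.of_eq (Set.disjoint_iff_inter_eq_empty.1 hd) hu).symm.compl_eq
    rwa [this]
  -- Take the clique of the split as large as possible. Then every vertex outside `C` misses some
  -- vertex of `C`, so its degree is below `C.card`, while degrees inside `C` are at least `C.card -
  -- 1`.
  obtain ⟨C, hC, hmax⟩ := Finset.exists_max_image (Finset.univ.filter Good) Finset.card
    (by obtain ⟨C, hC⟩ := hne; exact ⟨C, by simpa using hC⟩)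
  obtain ⟨hcl, hin⟩ := (Finset.mem_filter.1 hC).2
  have adjC : ∀ v ∈ C, ∀ w ∈ C, v ≠ w → G.Adj v w := fun v hv w hw h =>
    hcl (Finset.mem_coe.2 hv) (Finset.mem_coe.2 hw) h
  have nadjS : ∀ v ∉ C, ∀ w ∉ C, ¬ G.Adj v w := fun v hv w hw h =>
    hin (by simpa using hv) (by simpa using hw) h.ne h
  let d : V → ℕ := fun v => (Finset.univ.filter (G.Adj v)).card
  have hSub : ∀ s ∉ C, Finset.univ.filter (G.Adj s) ⊆ C := by
    intro s hs v hv
    by_contra hvC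
    exact nadjS s hs v hvC (Finset.mem_filter.1 hv).2
  have hmiss : ∀ s ∉ C, ∃ v ∈ C, ¬ G.Adj s v := by
    intro s hs
    by_contra! hall
    have hgood : Good (insert s C) := by
      refine ⟨?_, ?_⟩
      · rw [Finset.coe_insert]
        exact hcl.insert fun b hb _ => hall b hb
      · intro v hv w hw
        simp only [Finset.coe_insert, Set.mem_compl_iff, Set.mem_insert_iff, not_or,
          Finset.mem_coe] at hv hw
        exact fun _ => nadjS v hv.2 w hw.2
    have := hmax _ (Finset.mem_filter.2 ⟨Finset.mem_univ _, hgood⟩)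
    rw [Finset.card_insert_of_notMem hs] at this
    omega
  have hdS : ∀ s ∉ C, d s < C.card := by
    intro s hs
    obtain ⟨v, hv, hsv⟩ := hmiss s hs
    exact Finset.card_lt_card ⟨hSub s hs, fun h => hsv (Finset.mem_filter.1 (h hv)).2⟩
  have hdC : ∀ v ∈ C, C.card ≤ d v + 1 := by
    intro v hv
    have : C.erase v ⊆ Finset.univ.filter (G.Adj v) := fun w hw => by
      have := Finset.mem_erase.1 hw
      exact Finset.mem_filter.2 ⟨Finset.mem_univ _, adjC v hv w this.2 this.1.symm⟩
    have := Finset.card_le_card this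
    rw [Finset.card_erase_of_mem hv] at this
    change _ ≤ d v at this
    omega
  -- Only degree `C.card - 1` can occur both inside and outside `C`. If it does not occur outside,
  -- it is the threshold. If it does, at some `s`, then `s` misses exactly one `c ∈ C` and the
  -- threshold is `C.card`.
  by_cases hex : ∃ s ∉ C, C.card ≤ d s + 1
  · obtain ⟨s, hs, hds⟩ := hex
    obtain ⟨c, hc, hsc⟩ := hmiss s hs
    have hadj : ∀ v ∈ C, v ≠ c → G.Adj s v := by
      intro v hv hvc
      by_contra hsv
      have hsub : Finset.univ.filter (G.Adj s) ⊆ (C.erase c).erase v := fun w hw => by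
        have hw' := (Finset.mem_filter.1 hw).2
        refine Finset.mem_erase.2 ⟨?_, Finset.mem_erase.2 ⟨?_, hSub s hs hw⟩⟩
        · rintro rfl; exact hsv hw'
        · rintro rfl; exact hsc hw'
      have h1 := Finset.card_le_card hsub
      have hv' : v ∈ C.erase c := Finset.mem_erase.2 ⟨hvc, hv⟩
      have h2 := Finset.card_pos.2 ⟨v, hv'⟩
      rw [Finset.card_erase_of_mem hv'] at h1
      rw [Finset.card_erase_of_mem hc] at h1 h2
      change d s ≤ _ at h1
      omega
    -- A vertex of `C` of degree `C.card - 1` has all its neighbours in `C`. As `s` is adjacent to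
    -- all of `C` except `c`, only `c` can have this degree, and `c` may join the independent side.
    have hlow : ∀ v ∈ C, d v < C.card → ∀ w ∉ C, ¬ G.Adj v w := by
      intro v hv hdv w hw hvw
      have hsub : insert w (C.erase v) ⊆ Finset.univ.filter (G.Adj v) := fun u hu => by
        refine Finset.mem_filter.2 ⟨Finset.mem_univ _, ?_⟩
        rcases Finset.mem_insert.1 hu with rfl | hu
        · exact hvw
        · have := Finset.mem_erase.1 hu
          exact adjC v hv u this.2 this.1.symm
      have h1 := Finset.card_le_card hsub
      have h2 := Finset.card_pos.2 ⟨v, hv⟩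
      rw [Finset.card_insert_of_notMem (fun h => hw (Finset.mem_erase.1 h).2),
        Finset.card_erase_of_mem hv] at h1
      change _ ≤ d v at h1
      omega
    have hlowc : ∀ v ∈ C, d v < C.card → v = c := by
      intro v hv hdv
      by_contra hvc
      exact hlow v hv hdv s hs (hadj v hv hvc).symm
    refine ⟨C.card, Finset.card_le_univ C, ?_, ?_⟩
    · intro v hv w hw hvw
      refine adjC v ?_ w ?_ hvw
      · by_contra h; exact absurd (hdS v h) (not_lt.2 hv)
      · by_contra h; exact absurd (hdS w h) (not_lt.2 hw)
    · intro v hv w hw hvw hadj'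
      by_cases hvC : v ∈ C <;> by_cases hwC : w ∈ C
      · exact hvw ((hlowc v hvC hv).trans (hlowc w hwC hw).symm)
      · exact hlow v hvC hv w hwC hadj'
      · exact hlow w hwC hw v hvC hadj'.symm
      · exact nadjS v hvC w hwC hadj'
  · push Not at hex
    refine ⟨C.card - 1, (Nat.sub_le _ _).trans (Finset.card_le_univ C), ?_, ?_⟩
    · intro v hv w hw hvw
      have hv' : C.card - 1 ≤ d v := hv
      have hw' : C.card - 1 ≤ d w := hw
      refine adjC v ?_ w ?_ hvw
      · by_contra h; have := hex v h; omega
      · by_contra h; have := hex w h; omega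
    · intro v hv w hw _
      have hv' : d v < C.card - 1 := hv
      have hw' : d w < C.card - 1 := hw
      refine nadjS v ?_ w ?_
      · intro h; have := hdC v h; omega
      · intro h; have := hdC w h; omega

/-- The vertices of the product that are not adjacent to `a` or `b` and, if `a = b`, are `a` or
outside the product of the cliques `C` and `D`. -/
def prodRegion {V W : Type*} (G : SimpleGraph V) (H : SimpleGraph W) (C : Set V) (D : Set W)
    (a b : V × W) : Set (V × W) :=
  {v | ¬ (G.catProd H).Adj a v ∧ ¬ (G.catProd H).Adj b v ∧
    (a ≠ b ∨ ¬ (v.1 ∈ C ∧ v.2 ∈ D) ∨ v = a)}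

/-- Every nonempty independent set of the product of two splitgraphs lies in one of polynomially
many regions that induce bipartite graphs with prescribed sides. -/
theorem exists_prodRegion {V W : Type*} {G : SimpleGraph V} {H : SimpleGraph W} {C : Set V}
    {D : Set W} (hC : G.IsClique C) (hC' : G.IsIndepSet Cᶜ) (hD : H.IsClique D)
    (hD' : H.IsIndepSet Dᶜ) {I : Set (V × W)} (hI : (G.catProd H).IsIndepSet I)
    (hne : I.Nonempty) :
    ∃ a ∈ I, ∃ b ∈ I, I ⊆ prodRegion G H C D a b ∧
      (∀ v ∈ prodRegion G H C D a b, ∀ w ∈ prodRegion G H C D a b,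
        ((a.1 = b.1 ∧ v.2 ∈ D ∨ a.1 ≠ b.1 ∧ v.1 ∈ C) ↔
          (a.1 = b.1 ∧ w.2 ∈ D ∨ a.1 ≠ b.1 ∧ w.1 ∈ C)) → ¬ (G.catProd H).Adj v w) := by
  have hI' : ∀ v ∈ I, ∀ w ∈ I, ¬ (G.catProd H).Adj v w := fun v hv w hw h => hI hv hw h.ne h
  have hCi : ∀ v w, v ∉ C → w ∉ C → ¬ G.Adj v w := fun v w hv hw h => hC' hv hw h.ne h
  have hDi : ∀ v w, v ∉ D → w ∉ D → ¬ H.Adj v w := fun v w hv hw h => hD' hv hw h.ne h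
  by_cases h2 : ∃ a ∈ I, ∃ b ∈ I, a ≠ b ∧ (a.1 ∈ C ∧ a.2 ∈ D) ∧ (b.1 ∈ C ∧ b.2 ∈ D)
  · obtain ⟨a, ha, b, hb, hab, ⟨haC, haD⟩, ⟨hbC, hbD⟩⟩ := h2
    have hsub : I ⊆ prodRegion G H C D a b :=
      fun v hv => ⟨hI' a ha v hv, hI' b hb v hv, .inl hab⟩
    by_cases hab1 : a.1 = b.1
    · have hab2 : a.2 ≠ b.2 := fun h => hab (Prod.ext hab1 h)
      -- Since `a.2` and `b.2` differ, at least one of them differs from `v.2` and is adjacent to it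
      -- in the clique `D`. So adjacency of the first components would make `v` adjacent to `a` or
      -- `b`. Hence `v.1` is `a.1` or lies outside `C`.
      have key : ∀ v ∈ prodRegion G H C D a b, v.2 ∈ D → ¬ G.Adj a.1 v.1 := by
        intro v hv hvD hadj
        by_cases hva : a.2 = v.2
        · exact hv.2.1 ⟨hab1 ▸ hadj, hD hbD hvD (hva ▸ hab2.symm)⟩
        · exact hv.1 ⟨hadj, hD haD hvD hva⟩
      refine ⟨a, ha, b, hb, hsub, ?_⟩
      simp only [hab1, true_and, ne_eq, not_true, false_and, or_false]
      intro v hv w hw hvw hadj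
      by_cases hvD : v.2 ∈ D
      · have k1 := key v hv hvD
        have k2 := key w hw (hvw.1 hvD)
        by_cases hv1 : v.1 ∈ C
        · have : a.1 = v.1 := by by_contra h; exact k1 (hC haC hv1 h)
          exact k2 (this ▸ hadj.1)
        · by_cases hw1 : w.1 ∈ C
          · have : a.1 = w.1 := by by_contra h; exact k2 (hC haC hw1 h)
            exact k1 (this ▸ hadj.1.symm)
          · exact hCi _ _ hv1 hw1 hadj.1
      · exact hDi _ _ hvD (fun h => hvD (hvw.2 h)) hadj.2
    · have hab2 : a.2 = b.2 := by
        by_contra h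
        exact hI' a ha b hb ⟨hC haC hbC hab1, hD haD hbD h⟩
      have key : ∀ v ∈ prodRegion G H C D a b, v.1 ∈ C → ¬ H.Adj a.2 v.2 := by
        intro v hv hvC hadj
        by_cases hva : a.1 = v.1
        · exact hv.2.1 ⟨hC hbC hvC (hva ▸ Ne.symm hab1), hab2 ▸ hadj⟩
        · exact hv.1 ⟨hC haC hvC hva, hadj⟩
      refine ⟨a, ha, b, hb, hsub, ?_⟩
      simp only [hab1, ne_eq, not_false_eq_true, true_and, false_and, false_or]
      intro v hv w hw hvw hadj
      by_cases hvC : v.1 ∈ C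
      · have k1 := key v hv hvC
        have k2 := key w hw (hvw.1 hvC)
        by_cases hv1 : v.2 ∈ D
        · have : a.2 = v.2 := by by_contra h; exact k1 (hD haD hv1 h)
          exact k2 (this ▸ hadj.2)
        · by_cases hw1 : w.2 ∈ D
          · have : a.2 = w.2 := by by_contra h; exact k2 (hD haD hw1 h)
            exact k1 (this ▸ hadj.2.symm)
          · exact hDi _ _ hv1 hw1 hadj.2
      · exact hCi _ _ hvC (fun h => hvC (hvw.2 h)) hadj.1
  -- If `I` misses `C × D`, any `a ∈ I` will do. On the side with second component in `D`, all
  -- vertices other than `a` have first component outside `C`, and `a` has no neighbour in the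
  -- region.
  · obtain ⟨a, ha, haI⟩ : ∃ a ∈ I, ∀ v ∈ I, v.1 ∈ C ∧ v.2 ∈ D → v = a := by
      by_cases h1 : ∃ a ∈ I, a.1 ∈ C ∧ a.2 ∈ D
      · obtain ⟨a, ha, ha'⟩ := h1
        refine ⟨a, ha, fun v hv hv' => ?_⟩
        by_contra hva
        exact h2 ⟨v, hv, a, ha, hva, hv', ha'⟩
      · obtain ⟨a, ha⟩ := hne
        exact ⟨a, ha, fun v hv hv' => absurd ⟨v, hv, hv'⟩ h1⟩
    refine ⟨a, ha, a, ha, fun v hv => ⟨hI' a ha v hv, hI' a ha v hv,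
      .inr ?_⟩, ?_⟩
    · by_cases hv' : v.1 ∈ C ∧ v.2 ∈ D
      · exact .inr (haI v hv hv')
      · exact .inl hv'
    · simp only [true_and, ne_eq, not_true, false_and, or_false]
      intro v hv w hw hvw hadj
      by_cases hvD : v.2 ∈ D
      · have hwD := hvw.1 hvD
        rcases hv.2.2 with h | hvC | rfl
        · exact h rfl
        · rcases hw.2.2 with h | hwC | rfl
          · exact h rfl
          · exact hCi _ _ (fun h => hvC ⟨h, hvD⟩) (fun h => hwC ⟨h, hwD⟩) hadj.1
          · exact hv.1 hadj.symm
        · exact hw.1 hadj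
      · exact hDi _ _ hvD (fun h => hvD (hvw.2 h)) hadj.2

end SimpleGraph

/-! ## Independent sets of bipartite graphs by an auction -/

/-- The dichotomy "idle or progress" passes from single steps to a round. Applied twice, it lifts
from pairs to rows and from rows to sweeps. -/
theorem RAM.iterate_fixed_or_lt {σ : Type*} (f : ℕ → σ → σ) (Φ : σ → ℕ)
    (hf : ∀ k s, f k s = s ∨ Φ s < Φ (f k s)) (N : ℕ) (s : σ) :
    ((∀ k < N, f k s = s) ∧ iterate f N s = s) ∨ Φ s < Φ (iterate f N s) := by
  induction N with
  | zero => exact .inl ⟨fun _ h => absurd h (Nat.not_lt_zero _), rfl⟩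
  | succ N ih =>
    rcases ih with ⟨h₁, h₂⟩ | h
    · rw [iterate, h₂]
      rcases hf N s with h | h
      · refine .inl ⟨fun k hk => ?_, h⟩
        rcases Nat.lt_succ_iff_lt_or_eq.1 hk with hk | rfl
        · exact h₁ k hk
        · exact h
      · exact .inr h
    · rw [iterate]
      rcases hf N (iterate f N s) with h' | h'
      · rw [h']; exact .inr h
      · exact .inr (h.trans h')

theorem RAM.iterate_stuck_or_le {σ : Type*} (g : σ → σ) (Φ : σ → ℕ)
    (hg : ∀ s, g s = s ∨ Φ s < Φ (g s)) (N : ℕ) (s : σ) :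
    g (iterate (fun _ => g) N s) = iterate (fun _ => g) N s ∨
      N ≤ Φ (iterate (fun _ => g) N s) := by
  induction N with
  | zero => exact .inr (Nat.zero_le _)
  | succ N ih =>
    rw [iterate]
    rcases ih with h | h
    · rw [h]; exact .inl h
    · rcases hg (iterate (fun _ => g) N s) with h' | h'
      · rw [h']; exact .inl h'
      · exact .inr (h.trans_lt h')

theorem RAM.iterate_invariant {σ : Type*} {f : ℕ → σ → σ} {P : σ → Prop}
    (hf : ∀ k s, P s → P (f k s)) (N : ℕ) {s : σ} (hs : P s) : P (iterate f N s) := by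
  induction N with
  | zero => exact hs
  | succ N ih => exact hf N _ ih

namespace Auction

/-- Prices of the right vertices, and `i + 1` for a right vertex that is matched to `i`. -/
structure State where
  price : ℕ → ℕ
  mate : ℕ → ℕ

/-- The unmatched left vertex `i` may take the right vertex `j`, which has the least price among
the neighbours of `i`. -/
def Guard (E : ℕ → ℕ → Prop) (N c i j : ℕ) (s : State) : Prop :=
  E i j ∧ s.price j < c ∧ (∀ j' < N, s.mate j' ≠ i + 1) ∧
    ∀ j' < N, E i j' → s.price j ≤ s.price j'

/-- The vertex `i` takes the vertex `j` and raises its price. -/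
def take (i j : ℕ) (s : State) : State where
  price := Function.update s.price j (s.price j + 1)
  mate := Function.update s.mate j (i + 1)

open scoped Classical in
/-- One step of the auction. -/
noncomputable def step (E : ℕ → ℕ → Prop) (N c i j : ℕ) (s : State) : State :=
  if Guard E N c i j s then take i j s else s

/-- The auction with `N` sweeps over all pairs of vertices. -/
noncomputable def run (E : ℕ → ℕ → Prop) (N c : ℕ) : State :=
  RAM.iterate (fun _ => RAM.iterate (fun i => RAM.iterate (fun j => step E N c i j) N) N) N
    ⟨fun _ => 0, fun _ => 0⟩

/-- The mates form a matching. A right vertex once taken is only handed over, never released, so a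
nonzero price marks the matched ones. `slack` is approximate complementary slackness: a left vertex
holds a neighbour that was cheapest when taken, and prices never fall. -/
structure Inv (E : ℕ → ℕ → Prop) (c : ℕ) (s : State) : Prop where
  edge : ∀ i j, s.mate j = i + 1 → E i j
  inj : ∀ j j', s.mate j = s.mate j' → s.mate j ≠ 0 → j = j'
  zero : ∀ j, s.mate j = 0 ↔ s.price j = 0
  slack : ∀ i j j', s.mate j = i + 1 → E i j' → s.price j ≤ s.price j' + 1
  le : ∀ j, s.price j ≤ c

theorem Inv.step {E : ℕ → ℕ → Prop} {N c i j : ℕ} {s : State} (hE : ∀ i j, E i j → j < N)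
    (h : Inv E c s) : Inv E c (step E N c i j s) := by
  unfold Auction.step
  split_ifs with hg
  swap
  · exact h
  obtain ⟨hij, hc, hun, hmin⟩ := hg
  have hlt : ∀ k l, s.mate l = k + 1 → l < N := fun k l hl => hE k l (h.edge k l hl)
  have hun' : ∀ l, s.mate l ≠ i + 1 := fun l hl => hun l (hlt i l hl) hl
  constructor
  · intro k l hl
    by_cases hlj : l = j
    · subst hlj
      have : i = k := by simpa [take] using hl
      exact this ▸ hij
    · exact h.edge k l (by simpa [take, hlj] using hl)
  · intro l l' hl hl0
    by_cases hlj : l = j <;> by_cases hlj' : l' = j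
    · rw [hlj, hlj']
    · subst hlj
      exact absurd (by simpa [take, hlj'] using hl.symm) (hun' l')
    · subst hlj'
      exact absurd (by simpa [take, hlj] using hl) (hun' l)
    · exact h.inj l l' (by simpa [take, hlj, hlj'] using hl) (by simpa [take, hlj] using hl0)
  · intro l
    by_cases hlj : l = j
    · subst hlj; simp [take]
    · simpa [take, hlj] using h.zero l
  · intro k l l' hl hkl'
    have hle : s.price l' ≤ (take i j s).price l' := by
      by_cases hlj' : l' = j
      · subst hlj'; simp [take]
      · simp [take, hlj']
    refine le_trans ?_ (Nat.add_le_add_right hle 1)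
    by_cases hlj : l = j
    · subst hlj
      obtain rfl : i = k := by simpa [take] using hl
      simpa [take] using hmin l' (hE _ _ hkl') hkl'
    · simpa [take, hlj] using h.slack k l l' (by simpa [take, hlj] using hl) hkl'
  · intro l
    by_cases hlj : l = j
    · subst hlj; simpa [take] using hc
    · simpa [take, hlj] using h.le l

theorem inv_run {E : ℕ → ℕ → Prop} {N c : ℕ} (hE : ∀ i j, E i j → j < N) :
    Inv E c (run E N c) := by
  refine RAM.iterate_invariant (fun _ s hs => RAM.iterate_invariant (fun i s hs =>
    RAM.iterate_invariant (fun j s hs => hs.step hE) N hs) N hs) N ?_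
  constructor <;> simp

/-- The sum of the prices is at most `m * c < N`, and each sweep that changes something raises it.
So after `N` sweeps another sweep is idle, hence so is each of its steps. -/
theorem not_guard_run {E : ℕ → ℕ → Prop} {N c m : ℕ} (hE : ∀ i j, E i j → i < N ∧ j < m)
    (hm : m ≤ N) (hN : m * c < N) (i j : ℕ) : ¬ Guard E N c i j (run E N c) := by
  intro hg
  obtain ⟨hi, hj⟩ := hE i j hg.1
  let Φ : State → ℕ := fun s => ∑ j ∈ Finset.range m, s.price j
  have hstep : ∀ i j s, step E N c i j s = s ∨ Φ s < Φ (step E N c i j s) := by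
    intro i j s
    unfold step
    split_ifs with hg
    · refine .inr (Finset.sum_lt_sum (fun l _ => ?_)
        ⟨j, Finset.mem_range.2 (hE i j hg.1).2, by simp [take]⟩)
      by_cases hl : l = j
      · subst hl; simp [take]
      · simp [take, hl]
    · exact .inl rfl
  have hrow := fun i s => RAM.iterate_fixed_or_lt (step E N c i) Φ (hstep i) N s
  have hsweep := fun s => RAM.iterate_fixed_or_lt
    (fun i => RAM.iterate (fun j => step E N c i j) N) Φ
    (fun i s => (hrow i s).imp_left And.right) N s
  have hinv : Inv E c (run E N c) := inv_run fun i j h => (hE i j h).2.trans_le hm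
  have hΦ : Φ (run E N c) ≤ m * c := by
    simpa using Finset.sum_le_card_nsmul (Finset.range m) _ c fun j _ => hinv.le j
  rcases RAM.iterate_stuck_or_le _ Φ (fun s => (hsweep s).imp_left And.right) N
    ⟨fun _ => 0, fun _ => 0⟩ with h | h
  · change RAM.iterate _ N (run E N c) = run E N c at h
    have h1 : ∀ k < N, RAM.iterate (fun j => step E N c k j) N (run E N c) = run E N c := by
      rcases hsweep (run E N c) with h' | h'
      · exact h'.1
      · rw [h] at h'; exact absurd h' (lt_irrefl _)
    have h2 : step E N c i j (run E N c) = run E N c := by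
      rcases hrow i (run E N c) with h' | h'
      · exact h'.1 j (hj.trans_le hm)
      · have h1' := h1 i hi
        change RAM.iterate (step E N c i) N (run E N c) = run E N c at h1'
        rw [h1'] at h'; exact absurd h' (lt_irrefl _)
    rw [step, if_pos hg] at h2
    have := congrArg (fun s => s.price j) h2
    simp [take] at this
  · exact absurd (h.trans hΦ) (not_le.2 hN)

/-- No independent set exceeds the number of vertices minus the number of matched vertices. -/
theorem Inv.card_le {A : ℕ → ℕ → Prop} (L R I : Finset ℕ) {c : ℕ} {s : State}
    (hLR : Disjoint L R) (h : Inv (fun i j => i ∈ L ∧ j ∈ R ∧ A i j) c s)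
    (hI : I ⊆ L ∪ R) (hIA : ∀ v ∈ I, ∀ w ∈ I, ¬ A v w) :
    I.card + (R.filter fun j => s.price j ≠ 0).card ≤ L.card + R.card := by
  -- Each matched edge has an end outside `I`: the right one if possible, otherwise the left one.
  -- Different edges give different ends.
  let φ : ℕ → ℕ := fun j => if j ∈ I then s.mate j - 1 else j
  have hmate : ∀ j, s.price j ≠ 0 → ∃ i, s.mate j = i + 1 ∧ i ∈ L ∧ j ∈ R ∧ A i j := by
    intro j hj
    obtain ⟨i, hi⟩ := Nat.exists_eq_succ_of_ne_zero (fun h0 => hj ((h.zero j).1 h0))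
    exact ⟨i, hi, h.edge i j hi⟩
  have hle : (R.filter fun j => s.price j ≠ 0).card ≤ ((L ∪ R) \ I).card := by
    refine Finset.card_le_card_of_injOn φ ?_ ?_
    · intro j hj
      obtain ⟨hjR, hj⟩ := Finset.mem_filter.1 (Finset.mem_coe.1 hj)
      obtain ⟨i, hi, hiL, -, hA⟩ := hmate j hj
      rw [Finset.mem_coe, Finset.mem_sdiff, Finset.mem_union]
      by_cases hjI : j ∈ I
      · simp only [φ, hjI, if_true, hi, Nat.add_sub_cancel]
        exact ⟨.inl hiL, fun hiI => hIA i hiI j hjI hA⟩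
      · simp only [φ, hjI, if_false]
        exact ⟨.inr hjR, not_false⟩
    · intro j hj j' hj' hjj'
      obtain ⟨hjR, hj⟩ := Finset.mem_filter.1 (Finset.mem_coe.1 hj)
      obtain ⟨hjR', hj'⟩ := Finset.mem_filter.1 (Finset.mem_coe.1 hj')
      obtain ⟨i, hi, hiL, -, -⟩ := hmate j hj
      obtain ⟨i', hi', hiL', -, -⟩ := hmate j' hj'
      by_cases hjI : j ∈ I <;> by_cases hjI' : j' ∈ I <;>
        simp only [φ, hjI, hjI', if_true, if_false, hi, hi', Nat.add_sub_cancel] at hjj'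
      · exact h.inj j j' (by rw [hi, hi', hjj']) (by simp [hi])
      · exact absurd hjR' (Finset.disjoint_left.1 hLR (hjj' ▸ hiL))
      · exact absurd hjR (Finset.disjoint_left.1 hLR (hjj' ▸ hiL'))
      · exact hjj'
  have := Finset.card_sdiff_add_card_eq_card hI
  rw [Finset.card_union_of_disjoint hLR] at this
  omega

/-- When the auction is over, the bound is attained. -/
theorem Inv.exists_card {A : ℕ → ℕ → Prop} (hA : ∀ v w, A v w → A w v) (L R : Finset ℕ)
    {N c : ℕ} {s : State} (hLR : Disjoint L R) (hL : ∀ v ∈ L, ∀ w ∈ L, ¬ A v w)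
    (hR : ∀ v ∈ R, ∀ w ∈ R, ¬ A v w) (hc : R.card < c)
    (h : Inv (fun i j => i ∈ L ∧ j ∈ R ∧ A i j) c s)
    (hs : ∀ i j, ¬ Guard (fun i j => i ∈ L ∧ j ∈ R ∧ A i j) N c i j s) :
    ∃ I ⊆ L ∪ R, (∀ v ∈ I, ∀ w ∈ I, ¬ A v w) ∧
      L.card + R.card ≤ I.card + (R.filter fun j => s.price j ≠ 0).card := by
  classical
  -- By pigeonhole some level `t` between 1 and `c` is not a price in `R`. The independent set
  -- consists of the right vertices cheaper than `t` and the left vertices without such a neighbour.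
  obtain ⟨t, ht, htR⟩ : ∃ t ∈ Finset.Icc 1 c, t ∉ R.image s.price :=
    Finset.exists_mem_notMem_of_card_lt_card (by
      rw [Nat.card_Icc]; exact Finset.card_image_le.trans_lt (by omega))
  obtain ⟨ht1, htc⟩ := Finset.mem_Icc.1 ht
  have htR' : ∀ j ∈ R, s.price j ≠ t := fun j hj hjt => htR (Finset.mem_image.2 ⟨j, hj, hjt⟩)
  let P : ℕ → Prop := fun i => ∃ j ∈ R, A i j ∧ s.price j < t
  -- A left vertex with a neighbour cheaper than `t ≤ c` is matched, or the guard would hold. By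
  -- `slack` its mate costs at most `t`, and not exactly `t`, so the mate is also cheaper than `t`.
  have hcov : (L.filter P).card ≤ (R.filter fun j => s.price j ≠ 0 ∧ s.price j < t).card := by
    refine Finset.card_le_card_of_surjOn (fun j => s.mate j - 1) ?_
    intro i hi
    obtain ⟨hiL, j, hjR, hij, hjt⟩ := Finset.mem_filter.1 (Finset.mem_coe.1 hi)
    obtain ⟨j₀, hj₀, hmin⟩ := Finset.exists_min_image (R.filter (A i)) s.price
      ⟨j, Finset.mem_filter.2 ⟨hjR, hij⟩⟩
    obtain ⟨hj₀R, hij₀⟩ := Finset.mem_filter.1 hj₀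
    have hj₀t : s.price j₀ < t := (hmin j (Finset.mem_filter.2 ⟨hjR, hij⟩)).trans_lt hjt
    obtain ⟨l, hl⟩ : ∃ l, s.mate l = i + 1 := by
      by_contra! hun
      exact hs i j₀ ⟨⟨hiL, hj₀R, hij₀⟩, by omega, fun j' _ => hun j',
        fun j' _ hj' => hmin j' (Finset.mem_filter.2 ⟨hj'.2.1, hj'.2.2⟩)⟩
    have hlR := (h.edge i l hl).2.1
    have := h.slack i l j₀ hl ⟨hiL, hj₀R, hij₀⟩
    have := htR' l hlR
    refine ⟨l, Finset.mem_coe.2 (Finset.mem_filter.2 ⟨hlR, ?_, by omega⟩), by simp [hl]⟩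
    rw [Ne, ← h.zero, hl]
    exact Nat.succ_ne_zero i
  refine ⟨(L.filter fun i => ¬ P i) ∪ R.filter fun j => s.price j < t,
    Finset.union_subset_union (Finset.filter_subset _ _) (Finset.filter_subset _ _), ?_, ?_⟩
  · intro v hv w hw hvw
    simp only [Finset.mem_union, Finset.mem_filter] at hv hw
    rcases hv with ⟨hv, hv'⟩ | ⟨hv, hv'⟩ <;> rcases hw with ⟨hw, hw'⟩ | ⟨hw, hw'⟩
    · exact hL v hv w hw hvw
    · exact hv' ⟨w, hw, hvw, hw'⟩
    · exact hw' ⟨v, hv, hA _ _ hvw, hv'⟩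
    · exact hR v hv w hw hvw
  · rw [Finset.card_union_of_disjoint
      (hLR.mono (Finset.filter_subset _ _) (Finset.filter_subset _ _))]
    have h1 := Finset.card_filter_add_card_filter_not (s := L) P
    have h2 := Finset.card_filter_add_card_filter_not (s := R) (fun j => s.price j < t)
    have h3 := Finset.card_filter_add_card_filter_not
      (s := R.filter fun j => s.price j ≠ 0) (fun j => s.price j < t)
    rw [Finset.filter_filter, Finset.filter_filter] at h3
    have h4 : (R.filter fun j => ¬ s.price j < t) =
        R.filter fun j => s.price j ≠ 0 ∧ ¬ s.price j < t := by
      refine Finset.filter_congr fun j _ => ⟨fun hj => ⟨by omega, hj⟩, fun hj => hj.2⟩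
    rw [h4] at h2
    omega

end Auction

/-! ## Coding the vertices of the product by numbers -/

namespace SimpleGraph

variable {n m : ℕ} (G : SimpleGraph (Fin n)) (H : SimpleGraph (Fin m))

theorem adjArray_ne_zero {i j : ℕ} (hi : i < n) (hj : j < n) :
    G.adjArray (i * n + j) ≠ 0 ↔ G.Adj ⟨i, hi⟩ ⟨j, hj⟩ := by
  have key : ∀ i' j' : Fin n, i * n + j = n * i' + j' → (i' : ℕ) = i ∧ (j' : ℕ) = j := by
    intro i' j' h
    have h1 : (i * n + j) / n = i := by
      rw [mul_comm, Nat.mul_add_div (by omega), Nat.div_eq_of_lt hj, add_zero]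
    have h2 : (n * i' + j') / n = (i' : ℕ) := by
      rw [Nat.mul_add_div (by omega), Nat.div_eq_of_lt j'.2, add_zero]
    have h3 : (i' : ℕ) = i := by rw [← h2, ← h, h1]
    refine ⟨h3, ?_⟩
    rw [h3, mul_comm] at h
    omega
  unfold adjArray
  constructor
  · intro h
    split_ifs at h with h'
    · obtain ⟨i', j', hij, hadj⟩ := h'
      obtain ⟨h1, h2⟩ := key i' j' hij
      convert hadj using 1 <;> ext <;> simp [h1, h2]
    · exact absurd rfl h
  · intro h
    rw [if_pos ⟨⟨i, hi⟩, ⟨j, hj⟩, by simp [mul_comm], h⟩]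
    exact one_ne_zero

/-- The adjacency of the product on the codes `m * i + j` of the pairs `(i, j)`. -/
def CodeAdj (v w : ℕ) : Prop :=
  v < n * m ∧ w < n * m ∧ G.adjArray (v / m * n + w / m) ≠ 0 ∧
    H.adjArray (v % m * m + w % m) ≠ 0

/-- The degree in `G` of the first component of `v`. -/
noncomputable def codeDegFst (m v : ℕ) : ℕ :=
  ((Finset.range n).filter fun i => G.adjArray (v / m * n + i) ≠ 0).card

/-- The degree in `H` of the second component of `v`. -/
noncomputable def codeDegSnd (v : ℕ) : ℕ :=
  ((Finset.range m).filter fun i => H.adjArray (v % m * m + i) ≠ 0).card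

/-- The codes of `prodRegion` for the cliques given by degree thresholds `k` and `l`. -/
def CodeRegion (k l a b v : ℕ) : Prop :=
  v < n * m ∧ ¬ CodeAdj G H a v ∧ ¬ CodeAdj G H b v ∧
    (a ≠ b ∨ ¬ (k ≤ G.codeDegFst m v ∧ l ≤ H.codeDegSnd v) ∨ v = a)

/-- The side of the bipartition of `CodeRegion`. -/
def CodeSide (k l a b v : ℕ) : Prop :=
  a / m = b / m ∧ l ≤ H.codeDegSnd v ∨ a / m ≠ b / m ∧ k ≤ G.codeDegFst m v

variable {G H}

/-- The code of a vertex of the product. -/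
def code (x : Fin n × Fin m) : ℕ := (finProdFinEquiv x : Fin (n * m))

theorem code_lt (x : Fin n × Fin m) : code x < n * m := (finProdFinEquiv x).2

theorem code_injective : Function.Injective (code : Fin n × Fin m → ℕ) :=
  fun _ _ h => finProdFinEquiv.injective (Fin.ext h)

theorem exists_code {v : ℕ} (hv : v < n * m) : ∃ x : Fin n × Fin m, code x = v :=
  ⟨finProdFinEquiv.symm ⟨v, hv⟩, by simp [code, Nat.mod_add_div]⟩

theorem code_div (x : Fin n × Fin m) : code x / m = x.1 :=
  congrArg (fun y => (y.1 : ℕ)) (finProdFinEquiv.symm_apply_apply x)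

theorem code_mod (x : Fin n × Fin m) : code x % m = x.2 :=
  congrArg (fun y => (y.2 : ℕ)) (finProdFinEquiv.symm_apply_apply x)

theorem codeAdj_code {x y : Fin n × Fin m} :
    CodeAdj G H (code x) (code y) ↔ (G.catProd H).Adj x y := by
  unfold CodeAdj
  rw [code_div, code_div, code_mod, code_mod, adjArray_ne_zero _ x.1.2 y.1.2,
    adjArray_ne_zero _ x.2.2 y.2.2]
  exact ⟨fun h => h.2.2, fun h => ⟨code_lt x, code_lt y, h⟩⟩

theorem CodeAdj.symm {v w : ℕ} (h : CodeAdj G H v w) : CodeAdj G H w v := by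
  obtain ⟨x, rfl⟩ := exists_code h.1
  obtain ⟨y, rfl⟩ := exists_code h.2.1
  exact codeAdj_code.2 (codeAdj_code.1 h).symm

theorem card_filter_range_adjArray [DecidableRel G.Adj] (v : Fin n) :
    ((Finset.range n).filter fun i => G.adjArray (v * n + i) ≠ 0).card =
      (Finset.univ.filter (G.Adj v)).card := by
  symm
  refine Finset.card_bij (fun i _ => (i : ℕ)) ?_ ?_ ?_
  · intro i hi
    rw [Finset.mem_filter, Finset.mem_range]
    exact ⟨i.2, (adjArray_ne_zero G v.2 i.2).2 (Finset.mem_filter.1 hi).2⟩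
  · intro i _ j _ h
    exact Fin.ext h
  · intro i hi
    rw [Finset.mem_filter, Finset.mem_range] at hi
    exact ⟨⟨i, hi.1⟩, Finset.mem_filter.2
      ⟨Finset.mem_univ _, (adjArray_ne_zero G v.2 hi.1).1 hi.2⟩, rfl⟩

/-- This gives soundness of the search: whatever is found among the codes comes from an independent
set of the product. -/
theorem card_le_indepNum_of_code {I : Finset ℕ} (hI : ∀ v ∈ I, v < n * m)
    (hA : ∀ v ∈ I, ∀ w ∈ I, ¬ CodeAdj G H v w) : I.card ≤ (G.catProd H).indepNum := by
  classical
  have hsub : I ⊆ (Finset.univ.filter fun x : Fin n × Fin m => code x ∈ I).image code := by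
    intro v hv
    obtain ⟨x, rfl⟩ := exists_code (hI v hv)
    exact Finset.mem_image_of_mem _ (Finset.mem_filter.2 ⟨Finset.mem_univ _, hv⟩)
  refine ((Finset.card_le_card hsub).trans Finset.card_image_le).trans
    (IsIndepSet.card_le_indepNum ?_)
  intro x hx y hy _ hadj
  exact hA _ (Finset.mem_filter.1 hx).2 _ (Finset.mem_filter.1 hy).2 (codeAdj_code.2 hadj)

/-- For suitable thresholds and codes, the region induces a bipartite graph with sides given by
`CodeSide`, and it contains a largest independent set. -/
theorem exists_codeRegion (hG : G.IsSplitgraph) (hH : H.IsSplitgraph)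
    (hpos : 0 < (G.catProd H).indepNum) :
    ∃ k ≤ n, ∃ l ≤ m, ∃ a < n * m, ∃ b < n * m,
      (∀ v w, CodeRegion G H k l a b v → CodeRegion G H k l a b w →
        (CodeSide G H k l a b v ↔ CodeSide G H k l a b w) → ¬ CodeAdj G H v w) ∧
      ∃ I : Finset ℕ, I.card = (G.catProd H).indepNum ∧ (∀ v ∈ I, CodeRegion G H k l a b v) ∧
        ∀ v ∈ I, ∀ w ∈ I, ¬ CodeAdj G H v w := by
  classical
  obtain ⟨k, hk, hC, hC'⟩ := hG.exists_threshold
  obtain ⟨l, hl, hD, hD'⟩ := hH.exists_threshold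
  obtain ⟨J, hJ, hJc⟩ := (G.catProd H).exists_isNIndepSet_indepNum
  have hJne : (J : Set (Fin n × Fin m)).Nonempty := by
    rw [Finset.coe_nonempty, ← Finset.card_pos, hJc]
    exact hpos
  have hcompl : ∀ {U : Type} (d : U → ℕ) (k : ℕ), {v | d v < k} = {v | k ≤ d v}ᶜ := by
    intro U d k
    ext v
    simp
  rw [hcompl] at hC' hD'
  rw [Fintype.card_fin] at hk hl
  obtain ⟨a, -, b, -, hsub, hbip⟩ := exists_prodRegion hC hC' hD hD' hJ hJne
  have hdG : ∀ x : Fin n × Fin m,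
      G.codeDegFst m (code x) = (Finset.univ.filter (G.Adj x.1)).card := fun x => by
    rw [← card_filter_range_adjArray, codeDegFst, code_div]
  have hdH : ∀ x : Fin n × Fin m,
      H.codeDegSnd (code x) = (Finset.univ.filter (H.Adj x.2)).card := fun x => by
    rw [← card_filter_range_adjArray, codeDegSnd, code_mod]
  have hreg : ∀ x, CodeRegion G H k l (code a) (code b) (code x) ↔
      x ∈ prodRegion G H {v | k ≤ (Finset.univ.filter (G.Adj v)).card}
        {v | l ≤ (Finset.univ.filter (H.Adj v)).card} a b := by
    intro x
    unfold CodeRegion prodRegion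
    rw [codeAdj_code, codeAdj_code, hdG, hdH, code_injective.ne_iff, code_injective.eq_iff]
    exact ⟨fun h => h.2, fun h => ⟨code_lt x, h⟩⟩
  have hside : ∀ x, CodeSide G H k l (code a) (code b) (code x) ↔
      (a.1 = b.1 ∧ l ≤ (Finset.univ.filter (H.Adj x.2)).card ∨
        a.1 ≠ b.1 ∧ k ≤ (Finset.univ.filter (G.Adj x.1)).card) := by
    intro x
    unfold CodeSide
    rw [hdG, hdH, code_div, code_div, Ne, Fin.val_inj]
  refine ⟨k, hk, l, hl, code a, code_lt a, code b, code_lt b, ?_, J.image code, ?_, ?_, ?_⟩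
  · intro v w hv hw hvw
    obtain ⟨x, rfl⟩ := exists_code hv.1
    obtain ⟨y, rfl⟩ := exists_code hw.1
    rw [hside, hside] at hvw
    rw [codeAdj_code]
    exact hbip x ((hreg x).1 hv) y ((hreg y).1 hw) hvw
  · rw [Finset.card_image_of_injective _ code_injective, hJc]
  · intro v hv
    obtain ⟨x, hx, rfl⟩ := Finset.mem_image.1 hv
    exact (hreg x).2 (hsub hx)
  · intro v hv w hw
    obtain ⟨x, hx, rfl⟩ := Finset.mem_image.1 hv
    obtain ⟨y, hy, rfl⟩ := Finset.mem_image.1 hw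
    rw [codeAdj_code]
    exact fun h => hJ hx hy h.ne h

end SimpleGraph

/-! ## Expressions for the product graph -/

namespace RAM

namespace RExpr

/-- Nonzero values count as true. Bound variables are 20 in `mul`, 21 in `fst`, 22 in the degrees,
and 23 and 24 in the quantifiers of the program. The side conditions `y ≠ 20`, `y ≠ 21`, `y ≠ 22`
below prevent capture. -/
def neg (e : RExpr) : RExpr := ite e (lit 0) (lit 1)
def conj (e₁ e₂ : RExpr) : RExpr := ite e₁ e₂ (lit 0)
def disj (e₁ e₂ : RExpr) : RExpr := ite e₁ (lit 1) e₂
def less (e₁ e₂ : RExpr) : RExpr := sub e₂ e₁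
def leq (e₁ e₂ : RExpr) : RExpr := neg (sub e₁ e₂)
def equal (e₁ e₂ : RExpr) : RExpr := conj (leq e₁ e₂) (leq e₂ e₁)
def forAll (x : ℕ) (e : RExpr) : RExpr := neg (sum x (neg e))
def count (x : ℕ) (e : RExpr) : RExpr := sum x (ite e (lit 1) (lit 0))

theorem neg_ne_zero {e : RExpr} {s : Mem} : e.neg.eval s ≠ 0 ↔ ¬ e.eval s ≠ 0 := by
  simp [neg, eval]

theorem conj_ne_zero {e₁ e₂ : RExpr} {s : Mem} :
    (conj e₁ e₂).eval s ≠ 0 ↔ e₁.eval s ≠ 0 ∧ e₂.eval s ≠ 0 := by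
  by_cases h : e₁.eval s = 0 <;> simp [conj, eval, h]

theorem disj_ne_zero {e₁ e₂ : RExpr} {s : Mem} :
    (disj e₁ e₂).eval s ≠ 0 ↔ e₁.eval s ≠ 0 ∨ e₂.eval s ≠ 0 := by
  by_cases h : e₁.eval s = 0 <;> simp [disj, eval, h]

theorem less_ne_zero {e₁ e₂ : RExpr} {s : Mem} :
    (less e₁ e₂).eval s ≠ 0 ↔ e₁.eval s < e₂.eval s := by
  simp only [less, eval]; omega

theorem leq_ne_zero {e₁ e₂ : RExpr} {s : Mem} :
    (leq e₁ e₂).eval s ≠ 0 ↔ e₁.eval s ≤ e₂.eval s := by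
  rw [leq, neg_ne_zero]; simp only [eval]; omega

theorem equal_ne_zero {e₁ e₂ : RExpr} {s : Mem} :
    (equal e₁ e₂).eval s ≠ 0 ↔ e₁.eval s = e₂.eval s := by
  rw [equal, conj_ne_zero, leq_ne_zero, leq_ne_zero]; omega

theorem forAll_ne_zero {x : ℕ} {e : RExpr} {s : Mem} :
    (forAll x e).eval s ≠ 0 ↔ ∀ k < s.var 2, e.eval (s.setVar x k) ≠ 0 := by
  rw [forAll, neg_ne_zero, not_not, eval, Finset.sum_eq_zero_iff]
  simp [neg, eval]

theorem eval_count {x : ℕ} {e : RExpr} {s : Mem} {P : ℕ → Prop} [DecidablePred P]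
    (h : ∀ k < s.var 2, e.eval (s.setVar x k) ≠ 0 ↔ P k) :
    (count x e).eval s = ((Finset.range (s.var 2)).filter P).card := by
  rw [count, eval, Finset.card_filter]
  refine Finset.sum_congr rfl fun k hk => ?_
  have := h k (Finset.mem_range.1 hk)
  by_cases hP : P k
  · simp [eval, hP, this.2 hP]
  · simp [eval, hP, not_not.1 (mt this.1 hP)]

/-- The product of `e₁` and `e₂`, where `e₁` is at most the value of variable 2. -/
def mul (e₁ e₂ : RExpr) : RExpr := sum 20 (ite (less (var 20) e₁) e₂ (lit 0))

/-- The product is a repeated addition, so `v` must not exceed the summation bound. Both operands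
are evaluated while variable 20 is bound and must not depend on it. -/
theorem eval_mul {e₁ e₂ : RExpr} {s : Mem} {v w : ℕ} (h₁ : ∀ k, e₁.eval (s.setVar 20 k) = v)
    (h₂ : ∀ k, e₂.eval (s.setVar 20 k) = w) (hv : v ≤ s.var 2) :
    (mul e₁ e₂).eval s = v * w := by
  have : ∀ k, (ite (less (var 20) e₁) e₂ (lit 0)).eval (s.setVar 20 k) =
      if k < v then w else 0 := by
    intro k
    simp only [less, eval, h₁, h₂, Mem.setVar_var_self]
    split_ifs <;> first | rfl | omega
  rw [mul, eval, Finset.sum_congr rfl fun k _ => this k]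
  rw [← Finset.sum_filter, Finset.sum_const, smul_eq_mul]
  congr 1
  rw [show (Finset.range (s.var 2)).filter (· < v) = Finset.range v by ext; simp; omega,
    Finset.card_range]

/-- The first component of the vertex with code in variable `y`. -/
def fst (y : ℕ) : RExpr := count 21 (leq (mul (add (var 21) (lit 1)) (var 1)) (var y))

/-- The second component of the vertex with code in variable `y`. -/
def snd (y : ℕ) : RExpr := sub (var y) (mul (fst y) (var 1))

/-- The adjacency of the vertices with codes in variables `y` and `z`. -/
def adj (y z : ℕ) : RExpr :=
  conj (less (var y) (var 3)) (conj (less (var z) (var 3))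
    (conj (get 0 (add (mul (fst y) (var 0)) (fst z))) (get 1 (add (mul (snd y) (var 1)) (snd z)))))

def degFst (y : ℕ) : RExpr :=
  count 22 (conj (less (var 22) (var 0)) (get 0 (add (mul (fst y) (var 0)) (var 22))))

def degSnd (y : ℕ) : RExpr :=
  count 22 (conj (less (var 22) (var 1)) (get 1 (add (mul (snd y) (var 1)) (var 22))))

def region (y : ℕ) : RExpr :=
  conj (less (var y) (var 3)) (conj (neg (adj 7 y)) (conj (neg (adj 8 y))
    (disj (neg (equal (var 7) (var 8))) (disj
      (neg (conj (leq (var 5) (degFst y)) (leq (var 6) (degSnd y)))) (equal (var y) (var 7))))))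

def side (y : ℕ) : RExpr :=
  disj (conj (equal (fst 7) (fst 8)) (leq (var 6) (degSnd y)))
    (conj (neg (equal (fst 7) (fst 8))) (leq (var 5) (degFst y)))

def left (y : ℕ) : RExpr := conj (region y) (side y)

def right (y : ℕ) : RExpr := conj (region y) (neg (side y))

end RExpr

/-- The memory holds the graphs `G` and `H`, the number of vertices of their product, and the
bound `N` for loops. -/
structure Loaded {n m : ℕ} (G : SimpleGraph (Fin n)) (H : SimpleGraph (Fin m)) (N : ℕ)
    (s : Mem) : Prop where
  var_zero : s.var 0 = n
  var_one : s.var 1 = m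
  var_two : s.var 2 = N
  var_three : s.var 3 = n * m
  arr_zero : s.arr 0 = G.adjArray
  arr_one : s.arr 1 = H.adjArray

namespace Loaded

variable {n m : ℕ} {G : SimpleGraph (Fin n)} {H : SimpleGraph (Fin m)} {N : ℕ} {s : Mem}

theorem setVar (h : Loaded G H N s) {x : ℕ} (hx : 3 < x) (v : ℕ) : Loaded G H N (s.setVar x v) := by
  constructor
  · rw [Mem.setVar_var_of_ne _ _ (by omega), h.var_zero]
  · rw [Mem.setVar_var_of_ne _ _ (by omega), h.var_one]
  · rw [Mem.setVar_var_of_ne _ _ (by omega), h.var_two]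
  · rw [Mem.setVar_var_of_ne _ _ (by omega), h.var_three]
  · exact h.arr_zero
  · exact h.arr_one

theorem eval_fst (h : Loaded G H N s) (hN : n * m < N) {y : ℕ} (hy : y ≠ 20 ∧ y ≠ 21)
    (hv : s.var y < n * m) : (RExpr.fst y).eval s = s.var y / m := by
  have hm : 0 < m := Nat.pos_of_ne_zero (by rintro rfl; simp at hv)
  rw [RExpr.fst, RExpr.eval_count (P := fun k => k < s.var y / m)]
  · have : s.var y / m ≤ s.var y := Nat.div_le_self _ _
    rw [h.var_two, show (Finset.range N).filter (· < s.var y / m) = Finset.range (s.var y / m) by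
      ext; simp; omega, Finset.card_range]
  · intro k hk
    rw [RExpr.leq_ne_zero, RExpr.eval_mul (v := k + 1) (w := m)]
    · rw [RExpr.eval, Mem.setVar_var_of_ne _ _ hy.2, Nat.lt_iff_add_one_le, Nat.le_div_iff_mul_le hm]
    · intro i; simp [RExpr.eval, Mem.setVar]
    · intro i; simp [RExpr.eval, Mem.setVar, h.var_one]
    · exact hk

theorem eval_snd (h : Loaded G H N s) (hN : n * m < N) {y : ℕ} (hy : y ≠ 20 ∧ y ≠ 21)
    (hv : s.var y < n * m) : (RExpr.snd y).eval s = s.var y % m := by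
  rw [RExpr.snd, RExpr.eval, RExpr.eval_mul (v := s.var y / m) (w := m)]
  · rw [RExpr.eval, Nat.mod_eq_sub_div_mul]
  · intro k
    have e : (s.setVar 20 k).var y = s.var y := Mem.setVar_var_of_ne _ _ hy.1
    rw [(h.setVar (by decide) k).eval_fst hN hy (by rwa [e]), e]
  · intro k; simp [RExpr.eval, Mem.setVar, h.var_one]
  · rw [h.var_two]; exact (Nat.div_le_self _ _).trans (hv.trans hN).le

theorem eval_fst_mul (h : Loaded G H N s) (hN : n * m < N) {y : ℕ} (hy : y ≠ 20 ∧ y ≠ 21)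
    (hv : s.var y < n * m) : (RExpr.mul (RExpr.fst y) (.var 0)).eval s = s.var y / m * n := by
  refine RExpr.eval_mul (fun k => ?_) (fun k => ?_) ?_
  · have e : (s.setVar 20 k).var y = s.var y := Mem.setVar_var_of_ne _ _ hy.1
    rw [(h.setVar (by decide) k).eval_fst hN hy (by rwa [e]), e]
  · exact (h.setVar (by decide) k).var_zero
  · rw [h.var_two]; exact (Nat.div_le_self _ _).trans (hv.trans hN).le

theorem eval_snd_mul (h : Loaded G H N s) (hN : n * m < N) {y : ℕ} (hy : y ≠ 20 ∧ y ≠ 21)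
    (hv : s.var y < n * m) : (RExpr.mul (RExpr.snd y) (.var 1)).eval s = s.var y % m * m := by
  refine RExpr.eval_mul (fun k => ?_) (fun k => ?_) ?_
  · have e : (s.setVar 20 k).var y = s.var y := Mem.setVar_var_of_ne _ _ hy.1
    rw [(h.setVar (by decide) k).eval_snd hN hy (by rwa [e]), e]
  · exact (h.setVar (by decide) k).var_one
  · rw [h.var_two]; exact (Nat.mod_le _ _).trans (hv.trans hN).le

theorem adj_ne_zero (h : Loaded G H N s) (hN : n * m < N) {y z : ℕ} (hy : y ≠ 20 ∧ y ≠ 21)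
    (hz : z ≠ 20 ∧ z ≠ 21) :
    (RExpr.adj y z).eval s ≠ 0 ↔ SimpleGraph.CodeAdj G H (s.var y) (s.var z) := by
  rw [RExpr.adj, RExpr.conj_ne_zero, RExpr.conj_ne_zero, RExpr.conj_ne_zero, RExpr.less_ne_zero,
    RExpr.less_ne_zero]
  simp only [RExpr.eval, h.var_three]
  refine and_congr_right fun hv => and_congr_right fun hw => ?_
  rw [h.eval_fst_mul hN hy hv, h.eval_fst hN hz hw, h.eval_snd_mul hN hy hv, h.eval_snd hN hz hw,
    h.arr_zero, h.arr_one]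

theorem eval_degFst (h : Loaded G H N s) (hN : n * m < N) (hn : n < N) {y : ℕ}
    (hy : y ≠ 20 ∧ y ≠ 21 ∧ y ≠ 22) (hv : s.var y < n * m) :
    (RExpr.degFst y).eval s = G.codeDegFst m (s.var y) := by
  rw [RExpr.degFst, RExpr.eval_count
    (P := fun k => k < n ∧ G.adjArray (s.var y / m * n + k) ≠ 0), h.var_two,
    SimpleGraph.codeDegFst]
  · congr 1
    ext k
    simp only [Finset.mem_filter, Finset.mem_range]
    exact ⟨fun hk => hk.2, fun hk => ⟨hk.1.trans hn, hk⟩⟩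
  · intro k _
    have h' := h.setVar (x := 22) (by decide) k
    have e : (s.setVar 22 k).var y = s.var y := Mem.setVar_var_of_ne _ _ hy.2.2
    rw [RExpr.conj_ne_zero, RExpr.less_ne_zero]
    simp only [RExpr.eval, h'.var_zero, Mem.setVar_var_self, h'.arr_zero]
    rw [h'.eval_fst_mul hN ⟨hy.1, hy.2.1⟩ (by rwa [e]), e]

theorem eval_degSnd (h : Loaded G H N s) (hN : n * m < N) (hm : m < N) {y : ℕ}
    (hy : y ≠ 20 ∧ y ≠ 21 ∧ y ≠ 22) (hv : s.var y < n * m) :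
    (RExpr.degSnd y).eval s = H.codeDegSnd (s.var y) := by
  rw [RExpr.degSnd, RExpr.eval_count
    (P := fun k => k < m ∧ H.adjArray (s.var y % m * m + k) ≠ 0), h.var_two,
    SimpleGraph.codeDegSnd]
  · congr 1
    ext k
    simp only [Finset.mem_filter, Finset.mem_range]
    exact ⟨fun hk => hk.2, fun hk => ⟨hk.1.trans hm, hk⟩⟩
  · intro k _
    have h' := h.setVar (x := 22) (by decide) k
    have e : (s.setVar 22 k).var y = s.var y := Mem.setVar_var_of_ne _ _ hy.2.2
    rw [RExpr.conj_ne_zero, RExpr.less_ne_zero]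
    simp only [RExpr.eval, h'.var_one, Mem.setVar_var_self, h'.arr_one]
    rw [h'.eval_snd_mul hN ⟨hy.1, hy.2.1⟩ (by rwa [e]), e]

theorem region_ne_zero (h : Loaded G H N s) (hN : n * m < N) (hn : n < N) (hm : m < N) {y : ℕ}
    (hy : y ≠ 20 ∧ y ≠ 21 ∧ y ≠ 22) :
    (RExpr.region y).eval s ≠ 0 ↔
      SimpleGraph.CodeRegion G H (s.var 5) (s.var 6) (s.var 7) (s.var 8) (s.var y) := by
  have hy' : y ≠ 20 ∧ y ≠ 21 := ⟨hy.1, hy.2.1⟩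
  simp only [RExpr.region, RExpr.conj_ne_zero, RExpr.disj_ne_zero, RExpr.neg_ne_zero,
    RExpr.less_ne_zero, RExpr.leq_ne_zero, RExpr.equal_ne_zero,
    h.adj_ne_zero hN (show 7 ≠ 20 ∧ 7 ≠ 21 by decide) hy',
    h.adj_ne_zero hN (show 8 ≠ 20 ∧ 8 ≠ 21 by decide) hy']
  simp only [RExpr.eval, h.var_three]
  refine and_congr_right fun hv => ?_
  rw [h.eval_degFst hN hn hy hv, h.eval_degSnd hN hm hy hv]

theorem side_ne_zero (h : Loaded G H N s) (hN : n * m < N) (hn : n < N) (hm : m < N) {y : ℕ}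
    (hy : y ≠ 20 ∧ y ≠ 21 ∧ y ≠ 22) (ha : s.var 7 < n * m) (hb : s.var 8 < n * m)
    (hv : s.var y < n * m) :
    (RExpr.side y).eval s ≠ 0 ↔
      SimpleGraph.CodeSide G H (s.var 5) (s.var 6) (s.var 7) (s.var 8) (s.var y) := by
  simp only [RExpr.side, RExpr.conj_ne_zero, RExpr.disj_ne_zero, RExpr.neg_ne_zero,
    RExpr.leq_ne_zero, RExpr.equal_ne_zero, h.eval_degFst hN hn hy hv, h.eval_degSnd hN hm hy hv,
    h.eval_fst hN (show 7 ≠ 20 ∧ 7 ≠ 21 by decide) ha,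
    h.eval_fst hN (show 8 ≠ 20 ∧ 8 ≠ 21 by decide) hb]
  rfl

end Loaded

end RAM

/-! ## The program -/

namespace RAM

theorem iterate_induction {σ : Type*} {f : ℕ → σ → σ} {N : ℕ} (P : ℕ → σ → Prop)
    (hf : ∀ k < N, ∀ s, P k s → P (k + 1) (f k s)) {s : σ} (hs : P 0 s) :
    P N (iterate f N s) := by
  induction N with
  | zero => exact hs
  | succ N ih => exact hf N N.lt_succ_self _ (ih fun k hk => hf k (hk.trans N.lt_succ_self))

namespace Stmt

/-- This transfers a step-by-step simulation to loops, and so relates the nested loops on the memory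
to the abstract auction. -/
theorem exec_iter_rel {σ : Type*} {x : ℕ} {p : Stmt} (Rel : Mem → σ → Prop) (f : ℕ → σ → σ)
    {N : ℕ} (h : ∀ k < N, ∀ s u, Rel s u → Rel (p.exec (s.setVar x k)) (f k u)) {s : Mem} {u : σ}
    (hN : s.var 2 = N) (hs : Rel s u) : Rel ((iter x p).exec s) (iterate f N u) := by
  rw [exec, hN]
  exact iterate_induction (fun k s => Rel s (iterate f k u)) (fun k hk s hs => h k hk s _ hs) hs

/-- No assignment to variable `x` occurs. -/
def fixesVar (x : ℕ) : Stmt → Bool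
  | assign y _ => decide (x ≠ y)
  | put _ _ _ => true
  | seq p q => p.fixesVar x && q.fixesVar x
  | cond _ p => p.fixesVar x
  | iter y p => decide (x ≠ y) && p.fixesVar x

/-- No write to array `a` occurs. -/
def fixesArr (a : ℕ) : Stmt → Bool
  | assign _ _ => true
  | put b _ _ => decide (a ≠ b)
  | seq p q => p.fixesArr a && q.fixesArr a
  | cond _ p => p.fixesArr a
  | iter _ p => p.fixesArr a

theorem exec_var {x : ℕ} {p : Stmt} (hp : p.fixesVar x = true) (s : Mem) :
    (p.exec s).var x = s.var x := by
  induction p generalizing s with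
  | assign y e => exact Mem.setVar_var_of_ne _ _ (of_decide_eq_true hp)
  | put a e₁ e₂ => rfl
  | seq p q ih₁ ih₂ =>
    simp only [fixesVar, Bool.and_eq_true] at hp
    rw [exec, ih₂ hp.2, ih₁ hp.1]
  | cond e p ih =>
    rw [exec]
    split_ifs
    · rfl
    · exact ih hp s
  | iter y p ih =>
    simp only [fixesVar, Bool.and_eq_true, decide_eq_true_eq] at hp
    rw [exec]
    refine iterate_invariant (P := fun s' : Mem => s'.var x = s.var x) (fun k s' h => ?_) _ rfl
    rw [ih hp.2, Mem.setVar_var_of_ne _ _ hp.1, h]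

theorem exec_arr {a : ℕ} {p : Stmt} (hp : p.fixesArr a = true) (s : Mem) :
    (p.exec s).arr a = s.arr a := by
  induction p generalizing s with
  | assign y e => rfl
  | put b e₁ e₂ => simp [exec, Mem.setArr, Function.update_of_ne (of_decide_eq_true hp)]
  | seq p q ih₁ ih₂ =>
    simp only [fixesArr, Bool.and_eq_true] at hp
    rw [exec, ih₂ hp.2, ih₁ hp.1]
  | cond e p ih =>
    rw [exec]
    split_ifs
    · rfl
    · exact ih hp s
  | iter y p ih =>
    rw [exec]
    refine iterate_invariant (P := fun s' : Mem => s'.arr a = s.arr a) (fun k s' h => ?_) _ rfl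
    rw [ih hp, Mem.setVar_arr, h]

end Stmt

theorem Loaded.of_eq {n m : ℕ} {G : SimpleGraph (Fin n)} {H : SimpleGraph (Fin m)} {N : ℕ}
    {s s' : Mem} (h : Loaded G H N s) (h' : ∀ x ≤ 3, s'.var x = s.var x)
    (h₀ : s'.arr 0 = s.arr 0) (h₁ : s'.arr 1 = s.arr 1) : Loaded G H N s' :=
  ⟨(h' 0 (by decide)).trans h.var_zero, (h' 1 (by decide)).trans h.var_one,
    (h' 2 (by decide)).trans h.var_two, (h' 3 le_rfl).trans h.var_three, h₀.trans h.arr_zero,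
    h₁.trans h.arr_one⟩

namespace RExpr

def edge (y z : ℕ) : RExpr := conj (left y) (conj (right z) (adj y z))

/-- The sides of the region are independent. -/
def check : RExpr :=
  conj (less (var 7) (var 3)) (conj (less (var 8) (var 3)) (forAll 23 (forAll 24
    (neg (conj (adj 23 24) (disj (conj (left 23) (left 24)) (conj (right 23) (right 24))))))))

/-- The guard of the auction: prices are in array 2, mates in array 3. -/
def guard : RExpr :=
  conj (edge 11 12) (conj (less (get 2 (var 12)) (add (var 3) (lit 1)))
    (conj (forAll 23 (neg (equal (get 3 (var 23)) (add (var 11) (lit 1)))))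
      (forAll 23 (disj (neg (edge 11 23)) (leq (get 2 (var 12)) (get 2 (var 23)))))))

/-- The number of unmatched vertices and of matched edges. -/
def result : RExpr := count 23 (disj (left 23) (conj (right 23) (neg (get 2 (var 23)))))

end RExpr

namespace Stmt

def clear : Stmt := iter 11 (seq (put 2 (.var 11) (.lit 0)) (put 3 (.var 11) (.lit 0)))

def auctionStep : Stmt :=
  cond .guard (seq (put 2 (.var 12) (.add (.get 2 (.var 12)) (.lit 1)))
    (put 3 (.var 12) (.add (.var 11) (.lit 1))))

def auction : Stmt := iter 13 (iter 11 (iter 12 auctionStep))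

def update : Stmt := seq (assign 14 .result) (cond (.less (.var 4) (.var 14)) (assign 4 (.var 14)))

def body : Stmt := cond .check (seq clear (seq auction update))

def search : Stmt := iter 5 (iter 6 (iter 7 (iter 8 body)))

end Stmt

/-! ### The computation for one choice of thresholds and vertices -/

section

open SimpleGraph

variable {n m : ℕ} (G : SimpleGraph (Fin n)) (H : SimpleGraph (Fin m))

open scoped Classical in
/-- The vertices of the region on the first side. -/
noncomputable def leftSet (k l a b : ℕ) : Finset ℕ :=
  (Finset.range (n * m)).filter fun v => CodeRegion G H k l a b v ∧ CodeSide G H k l a b v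

open scoped Classical in
/-- The vertices of the region on the second side. -/
noncomputable def rightSet (k l a b : ℕ) : Finset ℕ :=
  (Finset.range (n * m)).filter fun v => CodeRegion G H k l a b v ∧ ¬ CodeSide G H k l a b v

/-- The edges between the two sides. -/
def SideEdge (k l a b i j : ℕ) : Prop :=
  i ∈ leftSet G H k l a b ∧ j ∈ rightSet G H k l a b ∧ CodeAdj G H i j

variable {G H} {N k l a b : ℕ} {s : Mem}

theorem mem_leftSet {v : ℕ} :
    v ∈ leftSet G H k l a b ↔ CodeRegion G H k l a b v ∧ CodeSide G H k l a b v := by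
  classical
  rw [leftSet, Finset.mem_filter, Finset.mem_range]
  exact ⟨fun h => h.2, fun h => ⟨h.1.1, h⟩⟩

theorem mem_rightSet {v : ℕ} :
    v ∈ rightSet G H k l a b ↔ CodeRegion G H k l a b v ∧ ¬ CodeSide G H k l a b v := by
  classical
  rw [rightSet, Finset.mem_filter, Finset.mem_range]
  exact ⟨fun h => h.2, fun h => ⟨h.1.1, h⟩⟩

theorem disjoint_leftSet_rightSet : Disjoint (leftSet G H k l a b) (rightSet G H k l a b) :=
  Finset.disjoint_left.2 fun _ hv hw => (mem_rightSet.1 hw).2 (mem_leftSet.1 hv).2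

/-- The memory holds the graphs, the thresholds `k` and `l` and the vertices `a` and `b`. -/
structure Chosen (G : SimpleGraph (Fin n)) (H : SimpleGraph (Fin m)) (N k l a b : ℕ)
    (s : Mem) : Prop where
  loaded : Loaded G H N s
  var_five : s.var 5 = k
  var_six : s.var 6 = l
  var_seven : s.var 7 = a
  var_eight : s.var 8 = b
  lt_left : a < n * m
  lt_right : b < n * m
  lt_bound : n * m < N
  fst_lt : n < N
  snd_lt : m < N

namespace Chosen

theorem of_eq (h : Chosen G H N k l a b s) {s' : Mem} (h' : ∀ x ≤ 8, s'.var x = s.var x)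
    (h₀ : s'.arr 0 = s.arr 0) (h₁ : s'.arr 1 = s.arr 1) : Chosen G H N k l a b s' :=
  ⟨h.loaded.of_eq (fun x hx => h' x (by omega)) h₀ h₁, (h' 5 (by decide)).trans h.var_five,
    (h' 6 (by decide)).trans h.var_six, (h' 7 (by decide)).trans h.var_seven,
    (h' 8 (by decide)).trans h.var_eight, h.lt_left, h.lt_right, h.lt_bound, h.fst_lt, h.snd_lt⟩

theorem setVar (h : Chosen G H N k l a b s) {x : ℕ} (hx : 8 < x) (v : ℕ) :
    Chosen G H N k l a b (s.setVar x v) :=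
  h.of_eq (fun _ _ => Mem.setVar_var_of_ne _ _ (by omega)) rfl rfl

theorem left_ne_zero (h : Chosen G H N k l a b s) {y : ℕ} (hy : y ≠ 20 ∧ y ≠ 21 ∧ y ≠ 22) :
    (RExpr.left y).eval s ≠ 0 ↔ s.var y ∈ leftSet G H k l a b := by
  rw [RExpr.left, RExpr.conj_ne_zero, mem_leftSet,
    h.loaded.region_ne_zero h.lt_bound h.fst_lt h.snd_lt hy, ← h.var_five, ← h.var_six,
    ← h.var_seven, ← h.var_eight]
  refine and_congr_right fun hr => ?_
  exact h.loaded.side_ne_zero h.lt_bound h.fst_lt h.snd_lt hy (h.var_seven ▸ h.lt_left)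
    (h.var_eight ▸ h.lt_right) hr.1

theorem right_ne_zero (h : Chosen G H N k l a b s) {y : ℕ} (hy : y ≠ 20 ∧ y ≠ 21 ∧ y ≠ 22) :
    (RExpr.right y).eval s ≠ 0 ↔ s.var y ∈ rightSet G H k l a b := by
  rw [RExpr.right, RExpr.conj_ne_zero, mem_rightSet, RExpr.neg_ne_zero,
    h.loaded.region_ne_zero h.lt_bound h.fst_lt h.snd_lt hy, ← h.var_five, ← h.var_six,
    ← h.var_seven, ← h.var_eight]
  refine and_congr_right fun hr => not_congr ?_
  exact h.loaded.side_ne_zero h.lt_bound h.fst_lt h.snd_lt hy (h.var_seven ▸ h.lt_left)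
    (h.var_eight ▸ h.lt_right) hr.1

theorem edge_ne_zero (h : Chosen G H N k l a b s) {y z : ℕ} (hy : y ≠ 20 ∧ y ≠ 21 ∧ y ≠ 22)
    (hz : z ≠ 20 ∧ z ≠ 21 ∧ z ≠ 22) :
    (RExpr.edge y z).eval s ≠ 0 ↔ SideEdge G H k l a b (s.var y) (s.var z) := by
  rw [RExpr.edge, RExpr.conj_ne_zero, RExpr.conj_ne_zero, h.left_ne_zero hy, h.right_ne_zero hz,
    h.loaded.adj_ne_zero h.lt_bound ⟨hy.1, hy.2.1⟩ ⟨hz.1, hz.2.1⟩]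
  rfl

/-- The quantifiers run up to `N` rather than `n * m`; the excess is harmless because `CodeAdj`
requires both codes to be in range. -/
theorem check_ne_zero (h : Chosen G H N k l a b s) :
    RExpr.check.eval s ≠ 0 ↔
      (∀ v ∈ leftSet G H k l a b, ∀ w ∈ leftSet G H k l a b, ¬ CodeAdj G H v w) ∧
        ∀ v ∈ rightSet G H k l a b, ∀ w ∈ rightSet G H k l a b, ¬ CodeAdj G H v w := by
  have key : RExpr.check.eval s ≠ 0 ↔ ∀ v < N, ∀ w < N, ¬ (CodeAdj G H v w ∧
      (v ∈ leftSet G H k l a b ∧ w ∈ leftSet G H k l a b ∨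
        v ∈ rightSet G H k l a b ∧ w ∈ rightSet G H k l a b)) := by
    rw [RExpr.check, RExpr.conj_ne_zero, RExpr.conj_ne_zero, RExpr.less_ne_zero,
      RExpr.less_ne_zero, RExpr.forAll_ne_zero]
    simp only [RExpr.eval, h.loaded.var_three, h.var_seven, h.var_eight, h.lt_left, h.lt_right,
      true_and, h.loaded.var_two]
    refine forall_congr' fun v => forall_congr' fun _ => ?_
    have h₁ := h.setVar (x := 23) (by decide) v
    rw [RExpr.forAll_ne_zero, h₁.loaded.var_two]
    refine forall_congr' fun w => forall_congr' fun _ => ?_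
    have h₂ := h₁.setVar (x := 24) (by decide) w
    rw [RExpr.neg_ne_zero, RExpr.conj_ne_zero, RExpr.disj_ne_zero, RExpr.conj_ne_zero,
      RExpr.conj_ne_zero, h₂.left_ne_zero (by decide), h₂.left_ne_zero (by decide),
      h₂.right_ne_zero (by decide), h₂.right_ne_zero (by decide),
      h₂.loaded.adj_ne_zero h.lt_bound (by decide) (by decide), Mem.setVar_var_self,
      Mem.setVar_var_of_ne _ _ (show 23 ≠ 24 by decide), Mem.setVar_var_self]
  rw [key]
  constructor
  · exact fun hk => ⟨fun v hv w hw hA => hk v (hA.1.trans h.lt_bound) w (hA.2.1.trans h.lt_bound)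
      ⟨hA, .inl ⟨hv, hw⟩⟩, fun v hv w hw hA => hk v (hA.1.trans h.lt_bound) w
      (hA.2.1.trans h.lt_bound) ⟨hA, .inr ⟨hv, hw⟩⟩⟩
  · rintro ⟨hL, hR⟩ v - w - ⟨hA, ⟨hv, hw⟩ | ⟨hv, hw⟩⟩
    · exact hL v hv w hw hA
    · exact hR v hv w hw hA

end Chosen

/-- The memory holds the state of the auction. -/
structure Holds (G : SimpleGraph (Fin n)) (H : SimpleGraph (Fin m)) (N k l a b best : ℕ)
    (s : Mem) (u : Auction.State) : Prop where
  chosen : Chosen G H N k l a b s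
  var_four : s.var 4 = best
  price : ∀ j < N, s.arr 2 j = u.price j
  mate : ∀ j < N, s.arr 3 j = u.mate j

variable {best : ℕ} {u : Auction.State}

theorem Holds.setVar (h : Holds G H N k l a b best s u) {x : ℕ} (hx : 8 < x) (v : ℕ) :
    Holds G H N k l a b best (s.setVar x v) u :=
  ⟨h.chosen.setVar hx v, (Mem.setVar_var_of_ne _ _ (by omega)).trans h.var_four, h.price, h.mate⟩

theorem Holds.guard_ne_zero (h : Holds G H N k l a b best s u) (hj : s.var 12 < N) :
    RExpr.guard.eval s ≠ 0 ↔
      Auction.Guard (SideEdge G H k l a b) N (n * m + 1) (s.var 11) (s.var 12) u := by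
  rw [RExpr.guard, RExpr.conj_ne_zero, RExpr.conj_ne_zero, RExpr.conj_ne_zero, RExpr.less_ne_zero,
    RExpr.forAll_ne_zero, RExpr.forAll_ne_zero, h.chosen.edge_ne_zero (by decide) (by decide),
    Auction.Guard, h.chosen.loaded.var_two]
  simp only [RExpr.eval, h.chosen.loaded.var_three, h.price _ hj]
  refine and_congr_right fun _ => and_congr_right fun _ => and_congr ?_ ?_
  · refine forall_congr' fun j' => forall_congr' fun hj' => ?_
    rw [RExpr.neg_ne_zero, RExpr.equal_ne_zero]
    simp [RExpr.eval, Mem.setVar, h.mate j' hj']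
  · refine forall_congr' fun j' => forall_congr' fun hj' => ?_
    rw [RExpr.disj_ne_zero, RExpr.neg_ne_zero, RExpr.leq_ne_zero,
      (h.chosen.setVar (x := 23) (by decide) j').edge_ne_zero (by decide) (by decide),
      Mem.setVar_var_self, Mem.setVar_var_of_ne _ _ (show 11 ≠ 23 by decide)]
    simp only [RExpr.eval, Mem.setVar_var_self, Mem.setVar_arr, h.price j' hj',
      Mem.setVar_var_of_ne _ _ (show 12 ≠ 23 by decide), h.price _ hj]
    exact imp_iff_not_or.symm

theorem Holds.auctionStep (h : Holds G H N k l a b best s u) (hj : s.var 12 < N) :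
    Holds G H N k l a b best (Stmt.auctionStep.exec s)
      (Auction.step (SideEdge G H k l a b) N (n * m + 1) (s.var 11) (s.var 12) u) := by
  rw [Stmt.auctionStep, Stmt.exec, Auction.step]
  by_cases hg : Auction.Guard (SideEdge G H k l a b) N (n * m + 1) (s.var 11) (s.var 12) u
  · rw [if_pos hg, if_neg ((h.guard_ne_zero hj).2 hg)]
    refine ⟨h.chosen.of_eq (fun _ _ => rfl) ?_ ?_, h.var_four, fun j hj' => ?_, fun j hj' => ?_⟩
    · simp [Stmt.exec, Mem.setArr]
    · simp [Stmt.exec, Mem.setArr]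
    · by_cases hjj : j = s.var 12
      · simp [Stmt.exec, Mem.setArr, Auction.take, RExpr.eval, hjj, h.price _ hj]
      · simp [Stmt.exec, Mem.setArr, Auction.take, RExpr.eval, hjj, h.price _ hj']
    · by_cases hjj : j = s.var 12
      · simp [Stmt.exec, Mem.setArr, Auction.take, RExpr.eval, hjj]
      · simp [Stmt.exec, Mem.setArr, Auction.take, RExpr.eval, hjj, h.mate _ hj']
  · rw [if_neg hg, if_pos (not_not.1 (mt (h.guard_ne_zero hj).1 hg))]
    exact h

theorem Holds.auction (h : Holds G H N k l a b best s ⟨fun _ => 0, fun _ => 0⟩) :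
    Holds G H N k l a b best (Stmt.auction.exec s)
      (Auction.run (SideEdge G H k l a b) N (n * m + 1)) := by
  refine Stmt.exec_iter_rel (Holds G H N k l a b best) _ (fun t _ s u h => ?_)
    h.chosen.loaded.var_two h
  refine Stmt.exec_iter_rel (Holds G H N k l a b best) _ (fun i _ s u h => ?_)
    (h.setVar (by decide) t).chosen.loaded.var_two (h.setVar (by decide) t)
  refine (Stmt.exec_iter_rel (fun s u => Holds G H N k l a b best s u ∧ s.var 11 = i) _
    (fun j hj s u h => ?_) (h.setVar (by decide) i).chosen.loaded.var_two
    ⟨h.setVar (by decide) i, Mem.setVar_var_self _ _ _⟩).1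
  have h' := (h.1.setVar (x := 12) (by decide) j).auctionStep (by simpa using hj)
  rw [Mem.setVar_var_self, Mem.setVar_var_of_ne _ _ (show 11 ≠ 12 by decide), h.2] at h'
  refine ⟨h', ?_⟩
  rw [Stmt.exec_var (by rfl), Mem.setVar_var_of_ne _ _ (show 11 ≠ 12 by decide), h.2]

theorem Chosen.clear (h : Chosen G H N k l a b s) :
    Holds G H N k l a b (s.var 4) (Stmt.clear.exec s) ⟨fun _ => 0, fun _ => 0⟩ := by
  have key := iterate_induction (N := N) (s := s) (f := fun i s' =>
      (Stmt.seq (.put 2 (.var 11) (.lit 0)) (.put 3 (.var 11) (.lit 0))).exec (s'.setVar 11 i))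
    (fun i s' => Chosen G H N k l a b s' ∧ s'.var 4 = s.var 4 ∧
      ∀ j < i, s'.arr 2 j = 0 ∧ s'.arr 3 j = 0) ?_ ⟨h, rfl, by simp⟩
  · rw [Stmt.clear, Stmt.exec, h.loaded.var_two]
    exact ⟨key.1, key.2.1, fun j hj => (key.2.2 j hj).1, fun j hj => (key.2.2 j hj).2⟩
  · rintro i - s' ⟨h₁, h₂, h₃⟩
    refine ⟨(h₁.setVar (x := 11) (by decide) i).of_eq (fun _ _ => rfl) ?_ ?_, ?_, fun j hj => ?_⟩
    · simp [Stmt.exec, Mem.setArr]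
    · simp [Stmt.exec, Mem.setArr]
    · simpa [Stmt.exec, Mem.setVar] using h₂
    · by_cases hji : j = i
      · simp [Stmt.exec, Mem.setArr, RExpr.eval, hji]
      · simpa [Stmt.exec, Mem.setArr, RExpr.eval, hji] using h₃ j (by omega)

/-- Matched right vertices are those of nonzero price, so counting the left vertices and the
unpriced right ones gives the number of vertices minus the size of the matching. -/
theorem Holds.eval_result (h : Holds G H N k l a b best s u) :
    RExpr.result.eval s + ((rightSet G H k l a b).filter fun j => u.price j ≠ 0).card =
      (leftSet G H k l a b).card + (rightSet G H k l a b).card := by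
  classical
  rw [RExpr.result, RExpr.eval_count (P := fun v => v ∈ leftSet G H k l a b ∨
    v ∈ rightSet G H k l a b ∧ ¬ u.price v ≠ 0), h.chosen.loaded.var_two]
  · have : (Finset.range N).filter (fun v => v ∈ leftSet G H k l a b ∨
        v ∈ rightSet G H k l a b ∧ ¬ u.price v ≠ 0) =
        leftSet G H k l a b ∪ (rightSet G H k l a b).filter fun v => ¬ u.price v ≠ 0 := by
      ext v
      simp only [Finset.mem_filter, Finset.mem_range, Finset.mem_union, and_iff_right_iff_imp]
      rintro (hv | hv)
      · exact (mem_leftSet.1 hv).1.1.trans h.chosen.lt_bound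
      · exact (mem_rightSet.1 hv.1).1.1.trans h.chosen.lt_bound
    rw [this, Finset.card_union_of_disjoint
      (disjoint_leftSet_rightSet.mono_right (Finset.filter_subset _ _)), add_assoc,
      add_comm (Finset.card _) (Finset.card _), Finset.card_filter_add_card_filter_not]
  · intro v hv
    rw [h.chosen.loaded.var_two] at hv
    have h' := h.chosen.setVar (x := 23) (by decide) v
    rw [RExpr.disj_ne_zero, RExpr.conj_ne_zero, RExpr.neg_ne_zero, h'.left_ne_zero (by decide),
      h'.right_ne_zero (by decide), Mem.setVar_var_self]
    simp only [RExpr.eval, Mem.setVar_var_self, Mem.setVar_arr, h.price v hv]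

/-- The body replaces variable 4 by the independence number of the region, if this is larger. -/
theorem Chosen.body (h : Chosen G H N k l a b s) (hN : n * m * (n * m + 1) < N) :
    s.var 4 ≤ (Stmt.body.exec s).var 4 ∧
    (s.var 4 ≤ (G.catProd H).indepNum → (Stmt.body.exec s).var 4 ≤ (G.catProd H).indepNum) ∧
    ((∀ v w, CodeRegion G H k l a b v → CodeRegion G H k l a b w →
        (CodeSide G H k l a b v ↔ CodeSide G H k l a b w) → ¬ CodeAdj G H v w) →
      ∀ I : Finset ℕ, (∀ v ∈ I, CodeRegion G H k l a b v) →
        (∀ v ∈ I, ∀ w ∈ I, ¬ CodeAdj G H v w) → I.card ≤ (Stmt.body.exec s).var 4) := by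
  by_cases hc : RExpr.check.eval s = 0
  · rw [Stmt.body, Stmt.exec, if_pos hc]
    refine ⟨le_rfl, id, fun hbip => ?_⟩
    refine absurd hc (h.check_ne_zero.2 ⟨fun v hv w hw => ?_, fun v hv w hw => ?_⟩)
    · rw [mem_leftSet] at hv hw
      exact hbip v w hv.1 hw.1 (iff_of_true hv.2 hw.2)
    · rw [mem_rightSet] at hv hw
      exact hbip v w hv.1 hw.1 (iff_of_false hv.2 hw.2)
  · classical
    obtain ⟨hL, hR⟩ := h.check_ne_zero.1 hc
    have hH := h.clear.auction
    set s₁ := Stmt.auction.exec (Stmt.clear.exec s) with hs₁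
    have hexec : (Stmt.body.exec s).var 4 = max (s.var 4) (RExpr.result.eval s₁) := by
      rw [Stmt.body, Stmt.exec, if_neg hc, Stmt.exec, Stmt.exec, ← hs₁, ← hH.var_four, Stmt.update,
        Stmt.exec, Stmt.exec, Stmt.exec]
      simp only [RExpr.less, RExpr.eval, Mem.setVar_var_self,
        Mem.setVar_var_of_ne _ _ (show 4 ≠ 14 by decide)]
      split_ifs with h0
      · rw [Mem.setVar_var_of_ne _ _ (show 4 ≠ 14 by decide)]; omega
      · rw [Stmt.exec, Mem.setVar_var_self, RExpr.eval, Mem.setVar_var_self]; omega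
    have hres := hH.eval_result
    have hE : ∀ i j, SideEdge G H k l a b i j → i < N ∧ j < n * m := fun i j hij =>
      ⟨hij.2.2.1.trans h.lt_bound, hij.2.2.2.1⟩
    have hinv : Auction.Inv (SideEdge G H k l a b) (n * m + 1)
        (Auction.run (SideEdge G H k l a b) N (n * m + 1)) :=
      Auction.inv_run fun i j hij => (hE i j hij).2.trans h.lt_bound
    have hstuck := Auction.not_guard_run hE h.lt_bound.le hN
    -- The price cap `n * m + 1` exceeds the number of right vertices, as the pigeonhole argument
    -- for the price gap requires.
    have hcard : (rightSet G H k l a b).card < n * m + 1 := Nat.lt_succ_of_le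
      ((Finset.card_filter_le _ _).trans (Finset.card_range _).le)
    obtain ⟨I, hI, hIA, hIc⟩ := Auction.Inv.exists_card (fun _ _ => CodeAdj.symm) _ _
      disjoint_leftSet_rightSet hL hR hcard hinv hstuck
    have hIle := card_le_indepNum_of_code (G := G) (H := H) (I := I) (fun v hv => by
      rcases Finset.mem_union.1 (hI hv) with hv | hv
      · exact (mem_leftSet.1 hv).1.1
      · exact (mem_rightSet.1 hv).1.1) hIA
    rw [hexec]
    refine ⟨le_max_left _ _, fun hle => max_le hle (by omega), fun _ I hI hIA => ?_⟩
    have := hinv.card_le _ _ I disjoint_leftSet_rightSet (fun v hv => by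
      rw [Finset.mem_union, mem_leftSet, mem_rightSet]
      by_cases hside : CodeSide G H k l a b v
      · exact .inl ⟨hI v hv, hside⟩
      · exact .inr ⟨hI v hv, hside⟩) hIA
    exact le_max_of_le_right (by omega)

end

end RAM

/-! ### The search over all choices -/

namespace RAM

section

open SimpleGraph

variable {n m : ℕ} {G : SimpleGraph (Fin n)} {H : SimpleGraph (Fin m)} {N α : ℕ}

/-- The invariant of the search: variable 4 does not exceed `α`. -/
def Bounded (G : SimpleGraph (Fin n)) (H : SimpleGraph (Fin m)) (N α : ℕ) (s : Mem) : Prop :=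
  Loaded G H N s ∧ s.var 4 ≤ α

theorem Bounded.setVar {s : Mem} (h : Bounded G H N α s) {x : ℕ} (hx : 4 < x) (v : ℕ) :
    Bounded G H N α (s.setVar x v) :=
  ⟨h.1.setVar (by omega) v, by rw [Mem.setVar_var_of_ne _ _ (by omega)]; exact h.2⟩

/-- The statement keeps the invariant and does not decrease variable 4. -/
def Improves (G : SimpleGraph (Fin n)) (H : SimpleGraph (Fin m)) (N α : ℕ) (p : Stmt) : Prop :=
  ∀ s, Bounded G H N α s → Bounded G H N α (p.exec s) ∧ s.var 4 ≤ (p.exec s).var 4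

theorem Improves.iter {p : Stmt} (hp : Improves G H N α p) {x : ℕ} (hx : 4 < x) :
    Improves G H N α (.iter x p) := by
  intro s hs
  rw [Stmt.exec]
  refine iterate_invariant (P := fun s' => Bounded G H N α s' ∧ s.var 4 ≤ s'.var 4)
    (fun k s' hs' => ?_) _ ⟨hs, le_rfl⟩
  obtain ⟨h₁, h₂⟩ := hp _ (hs'.1.setVar hx k)
  rw [Mem.setVar_var_of_ne _ _ (by omega)] at h₂
  exact ⟨h₁, hs'.2.trans h₂⟩

/-- If `p` reaches the value `α` for `x = k`, then so does the loop over `x`. -/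
theorem Improves.le_iter {p : Stmt} (hp : Improves G H N α p) {x k : ℕ} (hx : 4 < x) (hk : k < N)
    (K : Mem → Prop) (hK : ∀ s i, K s → K (p.exec (s.setVar x i)))
    (hK' : ∀ s i, K s → K (s.setVar x i))
    (hhit : ∀ s, Bounded G H N α s → K s → s.var x = k → α ≤ (p.exec s).var 4) {s : Mem}
    (hs : Bounded G H N α s) (hKs : K s) : α ≤ ((Stmt.iter x p).exec s).var 4 := by
  rw [Stmt.exec, hs.1.var_two]
  refine (iterate_induction (fun i s' => Bounded G H N α s' ∧ K s' ∧ (k < i → α ≤ s'.var 4))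
    (fun i _ s' hs' => ?_) ⟨hs, hKs, fun h => absurd h (Nat.not_lt_zero _)⟩).2.2 hk
  obtain ⟨h₁, h₂, h₃⟩ := hs'
  obtain ⟨h₄, h₅⟩ := hp _ (h₁.setVar hx i)
  refine ⟨h₄, hK _ _ h₂, fun hki => ?_⟩
  rcases Nat.lt_succ_iff_lt_or_eq.1 hki with hki | rfl
  · rw [Mem.setVar_var_of_ne _ _ (by omega)] at h₅
    exact (h₃ hki).trans h₅
  · exact hhit _ (h₁.setVar hx k) (hK' _ _ h₂) (Mem.setVar_var_self _ _ _)

theorem Loaded.exec_body {s : Mem} (h : Loaded G H N s) : Loaded G H N (Stmt.body.exec s) :=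
  h.of_eq (fun x hx => by interval_cases x <;> exact Stmt.exec_var (by rfl) s)
    (Stmt.exec_arr (by rfl) s) (Stmt.exec_arr (by rfl) s)

/-- The loops over variables 7 and 8 run up to `N`, beyond the codes of vertices; such rounds must
be idle. -/
theorem Stmt.exec_body_of_not_lt {s : Mem} (h : Loaded G H N s)
    (hlt : ¬ (s.var 7 < n * m ∧ s.var 8 < n * m)) : Stmt.body.exec s = s := by
  rw [Stmt.body, Stmt.exec, if_pos]
  by_contra hc
  change RExpr.check.eval s ≠ 0 at hc
  rw [RExpr.check, RExpr.conj_ne_zero, RExpr.conj_ne_zero, RExpr.less_ne_zero,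
    RExpr.less_ne_zero] at hc
  simp only [RExpr.eval, h.var_three] at hc
  exact hlt ⟨hc.1, hc.2.1⟩

theorem improves_body (hN : n * m * (n * m + 1) < N) (hnm : n * m < N) (hn : n < N) (hm : m < N) :
    Improves G H N (G.catProd H).indepNum .body := by
  intro s hs
  by_cases hlt : s.var 7 < n * m ∧ s.var 8 < n * m
  · have h := Chosen.body (G := G) (H := H) (s := s)
      ⟨hs.1, rfl, rfl, rfl, rfl, hlt.1, hlt.2, hnm, hn, hm⟩ hN
    exact ⟨⟨hs.1.exec_body, h.2.1 hs.2⟩, h.1⟩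
  · rw [Stmt.exec_body_of_not_lt hs.1 hlt]
    exact ⟨hs, le_rfl⟩

theorem Loaded.search {s : Mem} (h : Loaded G H N s) (h4 : s.var 4 = 0)
    (hN : n * m * (n * m + 1) < N) (hnm : n * m < N) (hn : n < N) (hm : m < N)
    (hG : G.IsSplitgraph) (hH : H.IsSplitgraph) :
    (Stmt.search.exec s).var 4 = (G.catProd H).indepNum := by
  have h₈ := improves_body (G := G) (H := H) hN hnm hn hm
  have h₇ := h₈.iter (x := 8) (by decide)
  have h₆ := h₇.iter (x := 7) (by decide)
  have h₅ := h₆.iter (x := 6) (by decide)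
  have hs : Bounded G H N (G.catProd H).indepNum s := ⟨h, by rw [h4]; exact Nat.zero_le _⟩
  refine le_antisymm (h₅.iter (x := 5) (by decide) s hs).1.2 ?_
  rcases Nat.eq_zero_or_pos (G.catProd H).indepNum with h0 | hpos
  · rw [h0]; exact Nat.zero_le _
  obtain ⟨k, hk, l, hl, a, ha, b, hb, hbip, I, hIc, hI, hIA⟩ := exists_codeRegion hG hH hpos
  have hset : ∀ {x y : ℕ} (s : Mem) (i : ℕ), x ≠ y → (s.setVar y i).var x = s.var x :=
    fun s i hxy => Mem.setVar_var_of_ne _ _ hxy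
  -- The four loops are entered at the right values `k`, `l`, `a`, `b` in turn. At each level the
  -- persistent property records the choices already made by the outer loops.
  refine h₅.le_iter (k := k) (by decide) (hk.trans_lt hn) (fun _ => True) (fun _ _ _ => trivial)
    (fun _ _ _ => trivial) (fun s hs _ e₅ => ?_) hs trivial
  refine h₆.le_iter (k := l) (by decide) (hl.trans_lt hm) (fun s => s.var 5 = k)
    (fun s i e => ?_) (fun s i e => ?_) (fun s hs e₅ e₆ => ?_) hs e₅
  · rw [Stmt.exec_var (by rfl), hset _ _ (by decide), e]
  · rw [hset _ _ (by decide), e]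
  refine h₇.le_iter (k := a) (by decide) (ha.trans hnm) (fun s => s.var 5 = k ∧ s.var 6 = l)
    (fun s i e => ?_) (fun s i e => ?_) (fun s hs e e₇ => ?_) hs ⟨e₅, e₆⟩
  · rw [Stmt.exec_var (by rfl), Stmt.exec_var (by rfl), hset _ _ (by decide),
      hset _ _ (by decide)]
    exact e
  · rw [hset _ _ (by decide), hset _ _ (by decide)]
    exact e
  refine h₈.le_iter (k := b) (by decide) (hb.trans hnm)
    (fun s => s.var 5 = k ∧ s.var 6 = l ∧ s.var 7 = a)
    (fun s i e => ?_) (fun s i e => ?_) (fun s hs e e₈ => ?_) hs ⟨e.1, e.2, e₇⟩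
  · rw [Stmt.exec_var (by rfl), Stmt.exec_var (by rfl), Stmt.exec_var (by rfl),
      hset _ _ (by decide), hset _ _ (by decide), hset _ _ (by decide)]
    exact e
  · rw [hset _ _ (by decide), hset _ _ (by decide), hset _ _ (by decide)]
    exact e
  rw [← hIc]
  exact (Chosen.body (G := G) (H := H) ⟨hs.1, e.1, e.2.1, e.2.2, e₈, ha, hb, hnm, hn, hm⟩ hN).2.2
    hbip I hI hIA

end

namespace Stmt

/-- Computes the fourth power of variable 2 in variable 3. -/
def fourthPower : Stmt := assign 3 (.sum 20 (.sum 21 (.sum 22 (.sum 23 (.lit 1)))))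

def main : Stmt := seq (assign 3 (.mul (.var 0) (.var 1))) (seq search (assign 0 (.var 4)))

end Stmt

/-- The program for the independence number of the product of two splitgraphs. -/
def mainProg : Prog :=
  .seq (.assign 2 (.add (.add (.var 0) (.var 1)) (.lit 2))) (.seq (Stmt.fourthPower.compile 30)
    (.seq (.assign 2 (.var 3)) (Stmt.main.compile 30)))

end RAM

/-- The independence number of the product of two splitgraphs is computable in polynomial time. -/
theorem mainTheorem2 :
    ∃ (p : RAM.Prog) (P : Polynomial ℕ),
      ∀ (n m : ℕ) (G : SimpleGraph (Fin n)) (H : SimpleGraph (Fin m)),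
        G.IsSplitgraph → H.IsSplitgraph →
          ∃ (t : ℕ) (s : RAM.Mem), RAM.Runs p (RAM.inputMem G H) t s ∧
            t ≤ P.eval (n + m) ∧ s.var 0 = (G.catProd H).indepNum := by
  open RAM in
  -- The fourth power is computed while variable 2 holds `n + m + 2`; the main statement runs with
  -- its fourth power in variable 2. The terms 6 and 2 pay for the two assignments to that variable.
  refine ⟨mainProg, 6 + (Stmt.fourthPower.time.comp (.X + 2) +
    (2 + Stmt.main.time.comp ((.X + 2) ^ 4))), fun n m G H hG hH => ?_⟩
  set M := n + m + 2 with hM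
  set s₀ := inputMem G H with hs₀
  have r₁ := RunsIn.assign 2 (.add (.add (.var 0) (.var 1)) (.lit 2)) s₀
  rw [show Expr.eval s₀ (.add (.add (.var 0) (.var 1)) (.lit 2)) = M by
    simp [Expr.eval, hs₀, inputMem, hM]] at r₁
  set s₁ := s₀.setVar 2 M with hs₁
  obtain ⟨s₂, r₂, a₂, -⟩ := Stmt.fourthPower.runsIn_compile (r₀ := 30) (by decide) (by rfl) le_rfl
    (Mem.Agree.refl 30 s₁)
  have e₂ : Stmt.fourthPower.exec s₁ = s₁.setVar 3 (M ^ 4) := by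
    have : s₁.var 2 = M := Mem.setVar_var_self _ _ _
    simp [Stmt.fourthPower, Stmt.exec, RExpr.eval, Mem.setVar_var_of_ne, this]
    ring_nf
  rw [e₂] at a₂
  have r₃ := RunsIn.assign 2 (.var 3) s₂
  rw [show Expr.eval s₂ (.var 3) = M ^ 4 by simp [Expr.eval, a₂.1 3 (by decide)]] at r₃
  set s₃ := s₂.setVar 2 (M ^ 4) with hs₃
  obtain ⟨s₄, r₄, a₄, -⟩ := Stmt.main.runsIn_compile (r₀ := 30) (by decide) (by rfl) le_rfl
    (Mem.Agree.refl 30 s₃)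
  obtain ⟨t, ht, hrun⟩ := r₁.seq (r₂.seq (r₃.seq r₄))
  refine ⟨t, s₄, hrun, ht.trans ?_, ?_⟩
  · simp [Expr.cost, hs₁, hs₃, hM]
  · have v : ∀ x < 30, x ≠ 2 → x ≠ 3 → s₃.var x = s₀.var x := fun x hx h2 h3 => by
      rw [Mem.setVar_var_of_ne _ _ h2, a₂.1 x hx, Mem.setVar_var_of_ne _ _ h3,
        Mem.setVar_var_of_ne _ _ h2]
    have v0 : s₃.var 0 = n := v 0 (by decide) (by decide) (by decide)
    have v1 : s₃.var 1 = m := v 1 (by decide) (by decide) (by decide)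
    have v2 : s₃.var 2 = M ^ 4 := Mem.setVar_var_self _ _ _
    have v4 : s₃.var 4 = 0 := v 4 (by decide) (by decide) (by decide)
    have arr : s₃.arr = s₀.arr := a₂.2
    -- The loop bound must exceed `n * m * (n * m + 1)`, the maximal total price: `n * m` right
    -- vertices with prices up to `n * m + 1`.
    have hM4 : (n * m + 1) * (n * m + 1) ≤ M ^ 4 := by
      have : n * m + 1 ≤ M ^ 2 := by rw [hM]; nlinarith
      calc (n * m + 1) * (n * m + 1) ≤ M ^ 2 * M ^ 2 := Nat.mul_le_mul this this
        _ = M ^ 4 := by ring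
    have hMle : M ≤ M ^ 4 := Nat.le_self_pow (by decide) M
    have e₃ : (RExpr.mul (.var 0) (.var 1)).eval s₃ = n * m :=
      RExpr.eval_mul (fun _ => v0) (fun _ => v1) (by rw [v2]; omega)
    have hload : Loaded G H (M ^ 4) (s₃.setVar 3 (n * m)) :=
      ⟨v0, v1, v2, Mem.setVar_var_self _ _ _, congrFun arr 0, congrFun arr 1⟩
    rw [a₄.1 0 (by decide), Stmt.main, Stmt.exec, Stmt.exec, Stmt.exec, Stmt.exec, e₃,
      Mem.setVar_var_self, RExpr.eval]
    exact hload.search v4 (by nlinarith) (by nlinarith) (by omega) (by omega) hG hH
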